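/- Let $\mathbf d=(d(1),\dots,d(n))$ be a sequence of positive integers with even sum; write $\Delta=\max_v d(v)$, $M=\sum_{v} d(v)$, and $d(S)=\sum_{v\in S}d(v)$ for $S\subseteq[n]$. Let $p\in(0,1)$. We consider $n\to\infty$, with $\mathbf d=\mathbf d(n)$ and $p=p(n)$. Assume that $p<1-\varepsilon$ for some constant $\varepsilon>0$, and that $$\Delta^2p^{-12}\log^{12}M\le\delta pM$$ for some $\delta=\delta(n)\to0$ with $\delta^{-1}=O(\log\log M)$. Put $c_p=\delta^{-1/16}p^{-1}\log M$. Let $G$ be a uniformly random simple graph on $[n]$ with degree sequence $\mathbf d$ (such graphs exist when $n$ is large) and, independently of $G$, let $S\subseteq[n]$ contain each vertex independently with probability $p$. Let $d_S(v)$ be the degree of $v\in S$ in the induced subgraph $G[S]$, and $\mathbf d_S$ the degree sequence of $G[S]$. For a sequence $\mathbf e$, let $n_i(\mathbf e)$ be the number of its entries equal to $i$. Let $X_j\sim\mathrm{Bin}(j,p)$ and let $\mathbf d_A$ be the sequence with $n_k(\mathbf d_A)=\tilde N(k)-\tilde N(k-1)$ for all $k\ge0$, where $\tilde N(-1)=0$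 and $\tilde N(k)=\big\lfloor p\sum_{v\in[n]}\Pr(X_{d(v)}\le k)+\tfrac12\big\rfloor$ for $k\ge0$. Then, with probability $1-o(1)$, all of the following hold. (a) $\big||S|-np\big|\le 3np\sqrt{\frac{\log n}{pn}}$. (b) $|d(S)-pM|\le pM\cdot\frac{p^2}{M^{1/4}}$. (c) $|d_S(v)-p\,d(v)|\le 9\delta^{1/64}\,p\,d(v)$ for all $v\in S$ with $d(v)>2\delta^{1/32}c_p$. (d) For all integers $0\le i\le\frac13pc_p$, $$|n_i(\mathbf d_S)-n_i(\mathbf d_A)|\le\frac{p\,n_i(\mathbf d_A)}{c_p^{3}}(1+o(1))+\frac{p\,c_p^{6}}{\sqrt{\log M}},$$ where the $o(1)$ is a deterministic quantity that tends to $0$ uniformly in $i$. -/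

import Mathlib

open Filter Topology Asymptotics MeasureTheory ProbabilityTheory

/-- The maximum entry `Δ(d)` of a finite sequence `d` of natural numbers. -/
def maxDegree {n : ℕ} (d : Fin n → ℕ) : ℕ := Finset.univ.sup d

/-- The total degree `M(d) = d([n])`. -/
def totalDegree {n : ℕ} (d : Fin n → ℕ) : ℕ := ∑ v, d v

open Classical in
/-- The total degree `d(S) = ∑_{v ∈ S} d(v)` of a set `S` of indices. -/
noncomputable def setDegree {n : ℕ} (d : Fin n → ℕ) (S : Set (Fin n)) : ℕ :=
  ∑ v with v ∈ S, d v

open Classical in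
/-- The set of all simple graphs on `{0, …, n - 1}` in which each vertex `v` has degree `d v`. -/
def graphsWithDegrees {n : ℕ} (d : Fin n → ℕ) : Set (SimpleGraph (Fin n)) :=
  {G | ∀ v, G.degree v = d v}

/-- Every set of graphs on finitely many vertices is measurable, so that events and the uniform
law below have their elementary meaning. -/
instance instMeasurableSingletonClassSimpleGraphFin (n : ℕ) :
    MeasurableSingletonClass (SimpleGraph (Fin n)) where
  measurableSet_singleton G := by
    refine ⟨{G.Adj}, measurableSet_singleton _, ?_⟩
    ext H
    simp

/-- The law of the pair `(G, S)`: `G` is a uniformly random graph with degree sequence `d`, and,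
independently of `G`, `S` is a random set containing each vertex independently with
probability `p`. The percolated random graph is the induced subgraph `G[S]`. -/
noncomputable def percolationLaw {n : ℕ} (d : Fin n → ℕ) (p : unitInterval) :
    Measure (SimpleGraph (Fin n) × Set (Fin n)) :=
  (uniformOn (graphsWithDegrees d)).prod (setBernoulli Set.univ p)

open Classical in
/-- The degree `d_S(v)` of a vertex `v ∈ S` in the induced subgraph `G[S]`. -/
noncomputable def inducedDegree {n : ℕ} (G : SimpleGraph (Fin n)) (S : Set (Fin n)) (v : S) : ℕ :=
  (G.induce S).degree v

open Classical in
/-- The degree sequence `d_S` of `G[S]`, as a multiset; `n_i(d_S)` is the multiplicity of `i`. -/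
noncomputable def inducedDegreeSeq {n : ℕ} (G : SimpleGraph (Fin n)) (S : Set (Fin n)) :
    Multiset ℕ :=
  (Finset.univ : Finset S).val.map (inducedDegree G S)

/-- `Ñ(k) = ⌊p ∑_v P(X_{d(v)} ≤ k) + 1/2⌋`, where `X_j` is binomial with parameters `j`, `p`. -/
noncomputable def modelCdf {n : ℕ} (d : Fin n → ℕ) (p : unitInterval) (k : ℕ) : ℕ :=
  ⌊(p : ℝ) * ∑ v, (binomial (d v) p).real (Set.Iic k) + 1 / 2⌋₊

/-- `Ñ(k) - Ñ(k-1)`, with `Ñ(-1) = 0`. -/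
noncomputable def modelCount {n : ℕ} (d : Fin n → ℕ) (p : unitInterval) : ℕ → ℕ
  | 0 => modelCdf d p 0
  | k + 1 => modelCdf d p (k + 1) - modelCdf d p k

/-- The model degree sequence `d_A`, as a multiset: it has `Ñ(k) - Ñ(k-1)` entries equal to `k`,
for every `k` (see `count_modelSeq`; there are no entries above the maximum of `d`). -/
noncomputable def modelSeq {n : ℕ} (d : Fin n → ℕ) (p : unitInterval) : Multiset ℕ :=
  ∑ k ∈ Finset.range (maxDegree d + 1), Multiset.replicate (modelCount d p k) k

/-- `Ñ` is monotone, so the subtraction in `modelCount` does not truncate. -/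
theorem modelCdf_mono {n : ℕ} (d : Fin n → ℕ) (p : unitInterval) : Monotone (modelCdf d p) := by
  intro k l hkl
  unfold modelCdf
  have hp : (0 : ℝ) ≤ p := p.2.1
  gcongr
  simp

theorem modelCdf_eq_of_le {n : ℕ} (d : Fin n → ℕ) (p : unitInterval) {k : ℕ}
    (hk : maxDegree d ≤ k) : modelCdf d p k = modelCdf d p (maxDegree d) := by
  have key : ∀ l, maxDegree d ≤ l → ∀ v, (binomial (d v) p).real (Set.Iic l) = 1 := by
    intro l hl v
    have h : ∀ᵐ x ∂(binomial (d v) p), x ≤ d v := ae_le_of_hasLaw_binomial (X := id) HasLaw.id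
    have hv : d v ≤ maxDegree d := Finset.le_sup (f := d) (Finset.mem_univ v)
    have h1 : binomial (d v) p (Set.Iic l) = 1 := by
      rw [← mem_ae_iff_prob_eq_one (by measurability)]
      filter_upwards [h] with x hx
      exact hx.trans (hv.trans hl)
    simp [measureReal_def, h1]
  unfold modelCdf
  simp [key k hk, key _ le_rfl]

/-- The number of entries of `d_A` equal to `k` is `Ñ(k) - Ñ(k-1)`, for every `k`. -/
theorem count_modelSeq {n : ℕ} (d : Fin n → ℕ) (p : unitInterval) (k : ℕ) :
    (modelSeq d p).count k = modelCount d p k := by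
  unfold modelSeq
  rw [Multiset.count_sum']
  simp only [Multiset.count_replicate]
  rw [Finset.sum_ite_eq']
  split_ifs with h
  · rfl
  · obtain _ | k := k
    · simp at h
    · simp only [Finset.mem_range, not_lt] at h
      simp only [modelCount]
      rw [modelCdf_eq_of_le d p (by omega), modelCdf_eq_of_le d p (k := k) (by omega)]
      simp

/-- The degree cutoff `c_p = δ^{-1/16} p⁻¹ log M`. -/
noncomputable def cutoff (δ p M : ℝ) : ℝ := δ ^ (-(1 / 16) : ℝ) * p⁻¹ * Real.log M

/-! All sample spaces are finite, so a probability is an average, over the graphs `G` with degrees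
`d`, of a weighted sum over subsets `S`. Every estimate below is made for fixed `n`, `d`, `p` with
an explicit failure probability; the limit is taken only at the end.

Parts (a) and (b) concern `S` alone and follow from Chebyshev's inequality: a random subset of total
weight `∑ w` has variance at most `p ∑ w²`. For (c), fix `G`. The number of retained neighbours of
`v` is binomial, Chernoff's inequality bounds its deviation with exponent at least a large multiple
of `log M`, and a union bound over at most `M` vertices costs `2 / M` in total.

Part (d) is the core. Vertices of degree above the cutoff keep more than `i` neighbours, unless (c)
fails for them, so only the set `T` of small vertices matters. The number of retained vertices of
`T` with exactly `i` retained neighbours has the same mean for every `G`, and this mean is the model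
count up to a bounded error. Its variance is bounded only on average over `G`. For fixed `G`, the
events for `u` and `v` depend on `S` inside the closed neighbourhoods of `u` and `v`. They are
independent when these are disjoint, and correlated by a factor at most `q⁻²` when they share at
most two vertices, where `q = pε` is at most `p` and `1 - p` (`bexp_mul_le`). A larger overlap
forces a triangle on `uv` or two common neighbours, and then a trivial bound is used
(`bexp_hitInd_mul_le`). These configurations are rare in a random graph: an edge switching shows
that a further prescribed edge `xy` has conditional probability at most `2 d(x) d(y) / M`
(`card_degreeFamilyContaining_insert_le`). Chebyshev's inequality and a union bound over `i` then
give (d), with failure probability of order `1 / log M`. -/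

/-! ### Random subsets: independence, correlation and tail bounds. -/

section BinomialSubset

open Finset

variable {V : Type*} [DecidableEq V]

/-- The expectation of `f S`, where the random subset `S` of `N` contains each element of `N`
independently with probability `p`. -/
noncomputable def bexp (p : ℝ) (N : Finset V) (f : Finset V → ℝ) : ℝ :=
  ∑ S ∈ N.powerset, p ^ #S * (1 - p) ^ #(N \ S) * f S

theorem bexp_empty (p : ℝ) (f : Finset V → ℝ) : bexp p ∅ f = f ∅ := by
  simp [bexp]

theorem bexp_congr {p : ℝ} {N : Finset V} {f g : Finset V → ℝ} (h : ∀ S ⊆ N, f S = g S) :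
    bexp p N f = bexp p N g :=
  Finset.sum_congr rfl fun S hS => by rw [h S (Finset.mem_powerset.1 hS)]

theorem bexp_insert (p : ℝ) {N : Finset V} {a : V} (ha : a ∉ N) (f : Finset V → ℝ) :
    bexp p (insert a N) f = (1 - p) * bexp p N f + p * bexp p N fun S => f (insert a S) := by
  unfold bexp
  rw [Finset.sum_powerset_insert ha, Finset.mul_sum, Finset.mul_sum]
  congr 1
  · refine Finset.sum_congr rfl fun S hS => ?_
    have haS : a ∉ S := fun h => ha (Finset.mem_powerset.1 hS h)
    rw [Finset.insert_sdiff_of_notMem _ haS, Finset.card_insert_of_notMem (by simp [ha])]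
    ring
  · refine Finset.sum_congr rfl fun S hS => ?_
    have haS : a ∉ S := fun h => ha (Finset.mem_powerset.1 hS h)
    rw [Finset.card_insert_of_notMem haS, Finset.insert_sdiff_insert,
      Finset.sdiff_insert_of_notMem ha]
    ring

theorem bexp_add (p : ℝ) (N : Finset V) (f g : Finset V → ℝ) :
    bexp p N (fun S => f S + g S) = bexp p N f + bexp p N g := by
  simp [bexp, mul_add, Finset.sum_add_distrib]

theorem bexp_const_mul (p : ℝ) (N : Finset V) (c : ℝ) (f : Finset V → ℝ) :
    bexp p N (fun S => c * f S) = c * bexp p N f := by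
  simp only [bexp, Finset.mul_sum]
  exact Finset.sum_congr rfl fun S _ => by ring

theorem bexp_mul_const (p : ℝ) (N : Finset V) (c : ℝ) (f : Finset V → ℝ) :
    bexp p N (fun S => f S * c) = bexp p N f * c := by
  simp only [mul_comm _ c, bexp_const_mul]

theorem bexp_sum {ι : Type*} (p : ℝ) (N : Finset V) (s : Finset ι) (f : ι → Finset V → ℝ) :
    bexp p N (fun S => ∑ i ∈ s, f i S) = ∑ i ∈ s, bexp p N (f i) := by
  simp only [bexp, Finset.mul_sum]
  exact Finset.sum_comm

theorem bexp_const (p : ℝ) (N : Finset V) (c : ℝ) : bexp p N (fun _ => c) = c := by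
  induction N using Finset.induction_on with
  | empty => simp [bexp_empty]
  | insert a N ha ih => rw [bexp_insert p ha, ih]; ring

theorem bexp_mono {p : ℝ} (hp : 0 ≤ p) (hp' : p ≤ 1) {N : Finset V} {f g : Finset V → ℝ}
    (h : ∀ S ⊆ N, f S ≤ g S) : bexp p N f ≤ bexp p N g := by
  refine Finset.sum_le_sum fun S hS => ?_
  have : 0 ≤ 1 - p := by linarith
  exact mul_le_mul_of_nonneg_left (h S (Finset.mem_powerset.1 hS)) (by positivity)

theorem bexp_nonneg {p : ℝ} (hp : 0 ≤ p) (hp' : p ≤ 1) {N : Finset V} {f : Finset V → ℝ}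
    (h : ∀ S ⊆ N, 0 ≤ f S) : 0 ≤ bexp p N f := by
  simpa [bexp_const] using bexp_mono (f := fun _ => 0) hp hp' h

theorem bexp_union (p : ℝ) {A B : Finset V} (h : Disjoint A B) (f : Finset V → ℝ) :
    bexp p (A ∪ B) f = bexp p A fun S => bexp p B fun T => f (S ∪ T) := by
  induction A using Finset.induction_on generalizing f with
  | empty => simp [bexp_empty]
  | insert a A ha ih =>
    rw [Finset.disjoint_insert_left] at h
    rw [Finset.insert_union, bexp_insert p (by simp [ha, h.1]), bexp_insert p ha, ih h.2, ih h.2]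
    simp only [Finset.insert_union]

/-- A function of `S` that only depends on `S ∩ A`. -/
def DependsOnInter (f : Finset V → ℝ) (A : Finset V) : Prop :=
  ∀ S T, S ∩ A = T ∩ A → f S = f T

theorem DependsOnInter.union_eq {f : Finset V → ℝ} {A S T : Finset V} (hf : DependsOnInter f A)
    (hT : Disjoint T A) : f (S ∪ T) = f S := by
  apply hf
  rw [Finset.union_inter_distrib_right, Finset.disjoint_iff_inter_eq_empty.1 hT, Finset.union_empty]

theorem DependsOnInter.union_eq' {f : Finset V → ℝ} {A S T : Finset V} (hf : DependsOnInter f A)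
    (hS : Disjoint S A) : f (S ∪ T) = f T := by
  rw [Finset.union_comm, hf.union_eq hS]

theorem DependsOnInter.bexp_eq {p : ℝ} {f : Finset V → ℝ} {A N : Finset V}
    (hf : DependsOnInter f A) (hA : A ⊆ N) : bexp p N f = bexp p A f := by
  rw [← Finset.union_sdiff_of_subset hA, bexp_union p Finset.disjoint_sdiff]
  refine bexp_congr fun S _ => ?_
  rw [bexp_congr (g := fun _ => f S) fun T hT => ?_, bexp_const]
  exact hf.union_eq (Finset.disjoint_of_subset_left hT Finset.sdiff_disjoint)

theorem bexp_mul_of_disjoint {p : ℝ} {f g : Finset V → ℝ} {A B N : Finset V}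
    (hf : DependsOnInter f A) (hg : DependsOnInter g B) (hA : A ⊆ N) (hB : B ⊆ N)
    (hAB : Disjoint A B) :
    bexp p N (fun S => f S * g S) = bexp p N f * bexp p N g := by
  have hB' : B ⊆ N \ A := fun x hx =>
    Finset.mem_sdiff.2 ⟨hB hx, fun h => Finset.disjoint_left.1 hAB h hx⟩
  rw [hf.bexp_eq hA, hg.bexp_eq hB, ← hg.bexp_eq hB', ← Finset.union_sdiff_of_subset hA,
    bexp_union p Finset.disjoint_sdiff, ← bexp_mul_const]
  refine bexp_congr fun S hS => ?_
  rw [← bexp_const_mul]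
  rw [Finset.union_sdiff_of_subset hA]
  refine bexp_congr fun T hT => ?_
  rw [hf.union_eq (Finset.disjoint_of_subset_left hT Finset.sdiff_disjoint),
    hg.union_eq' (Finset.disjoint_of_subset_left hS hAB)]

/-- Positive correlation through the common coordinates is bounded by a power of their number. -/
theorem bexp_mul_le {p q : ℝ} (hq : 0 < q) (hqp : q ≤ p) (hqp' : q ≤ 1 - p) {f g : Finset V → ℝ}
    {A B N : Finset V} (hf0 : ∀ S, 0 ≤ f S) (hg0 : ∀ S, 0 ≤ g S)
    (hf : DependsOnInter f A) (hg : DependsOnInter g B) (hA : A ⊆ N) (hB : B ⊆ N) :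
    bexp p N (fun S => f S * g S) * q ^ #(A ∩ B) ≤ bexp p N f * bexp p N g := by
  have hp : 0 ≤ p := by linarith
  have hp' : p ≤ 1 := by linarith
  set W := A ∩ B with hW
  have hWN : W ⊆ N := Finset.inter_subset_left.trans hA
  -- Summing `g` over all patterns `X` on the common coordinates `W` gives a majorant that ignores
  -- `W`, hence is independent of `f`. Every pattern has probability at least `q ^ #W`, so the mean
  -- grows by at most the factor `q⁻¹ ^ #W`.
  let g' : Finset V → ℝ := fun S => ∑ X ∈ W.powerset, g (S \ W ∪ X)
  have hg' : DependsOnInter g' (B \ W) := by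
    intro S T hST
    refine Finset.sum_congr rfl fun X hX => hg _ _ ?_
    ext x
    have := congrArg (x ∈ ·) hST
    simp only [Finset.mem_inter, Finset.mem_sdiff, eq_iff_iff, Finset.mem_union] at this ⊢
    tauto
  have h1 : bexp p N (fun S => f S * g S) ≤ bexp p N (fun S => f S * g' S) := by
    refine bexp_mono hp hp' fun S _ => mul_le_mul_of_nonneg_left ?_ (hf0 S)
    have : g S = g (S \ W ∪ S ∩ W) := by rw [Finset.sdiff_union_inter]
    rw [this]
    exact Finset.single_le_sum (f := fun X => g (S \ W ∪ X)) (fun X _ => hg0 _)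
      (Finset.mem_powerset.2 Finset.inter_subset_right)
  have hdisj : Disjoint A (B \ W) := by
    rw [Finset.disjoint_left]
    intro x hx hx'
    simp [hW, hx] at hx'
  rw [bexp_mul_of_disjoint hf hg' hA (Finset.sdiff_subset.trans hB) hdisj] at h1
  have h2 : bexp p N g' * q ^ #W ≤ bexp p N g := by
    have e1 : bexp p N g' = bexp p (N \ W) g' := by
      rw [hg'.bexp_eq (Finset.sdiff_subset.trans hB),
        hg'.bexp_eq (Finset.sdiff_subset_sdiff hB le_rfl)]
    have e2 : bexp p (N \ W) g' = ∑ X ∈ W.powerset, bexp p (N \ W) fun T => g (X ∪ T) := by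
      rw [← bexp_sum]
      refine bexp_congr fun T hT => Finset.sum_congr rfl fun X _ => ?_
      rw [Finset.union_comm X, Finset.sdiff_eq_self_of_disjoint
        (Finset.disjoint_of_subset_left hT Finset.sdiff_disjoint)]
    have e3 : bexp p N g = bexp p W fun X => bexp p (N \ W) fun T => g (X ∪ T) := by
      rw [← bexp_union p Finset.disjoint_sdiff, Finset.union_sdiff_of_subset hWN]
    rw [e1, e2, e3, Finset.sum_mul]
    refine Finset.sum_le_sum fun X hX => ?_
    rw [mul_comm]
    refine mul_le_mul_of_nonneg_right ?_ (bexp_nonneg hp hp' fun _ _ => hg0 _)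
    have : #W = #X + #(W \ X) := by
      rw [Finset.card_sdiff_of_subset (Finset.mem_powerset.1 hX)]
      have := Finset.card_le_card (Finset.mem_powerset.1 hX)
      omega
    rw [this, pow_add]
    gcongr
  calc _ ≤ bexp p N f * bexp p N g' * q ^ #W := by gcongr
    _ = bexp p N f * (bexp p N g' * q ^ #W) := by ring
    _ ≤ _ := mul_le_mul_of_nonneg_left h2 (bexp_nonneg hp hp' fun _ _ => hf0 _)

open Classical in
/-- The probability that a random subset `S` of `N` satisfies `P`. -/
noncomputable def bprob (p : ℝ) (N : Finset V) (P : Finset V → Prop) : ℝ :=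
  bexp p N fun S => if P S then 1 else 0

theorem bprob_nonneg {p : ℝ} (hp : 0 ≤ p) (hp' : p ≤ 1) (N : Finset V) (P : Finset V → Prop) :
    0 ≤ bprob p N P :=
  bexp_nonneg hp hp' fun _ _ => by split_ifs <;> norm_num

theorem bprob_mono {p : ℝ} (hp : 0 ≤ p) (hp' : p ≤ 1) {N : Finset V} {P Q : Finset V → Prop}
    (h : ∀ S, P S → Q S) : bprob p N P ≤ bprob p N Q :=
  bexp_mono hp hp' fun S _ => by
    by_cases hP : P S
    · simp [hP, h S hP]
    · rw [if_neg hP]; split_ifs <;> norm_num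

theorem bprob_compl (p : ℝ) (N : Finset V) (P : Finset V → Prop) :
    bprob p N P = 1 - bprob p N fun S => ¬ P S := by
  rw [eq_sub_iff_add_eq, bprob, bprob, ← bexp_add, bexp_congr (g := fun _ => 1), bexp_const]
  intro S _
  by_cases h : P S <;> simp [h]

theorem bprob_or_le {p : ℝ} (hp : 0 ≤ p) (hp' : p ≤ 1) (N : Finset V) (P Q : Finset V → Prop) :
    bprob p N (fun S => P S ∨ Q S) ≤ bprob p N P + bprob p N Q := by
  rw [bprob, bprob, bprob, ← bexp_add]
  refine bexp_mono hp hp' fun S _ => ?_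
  by_cases hP : P S <;> by_cases hQ : Q S <;> simp [hP, hQ]

theorem bprob_exists_le {ι : Type*} {p : ℝ} (hp : 0 ≤ p) (hp' : p ≤ 1) (N : Finset V)
    (s : Finset ι) (P : ι → Finset V → Prop) :
    bprob p N (fun S => ∃ i ∈ s, P i S) ≤ ∑ i ∈ s, bprob p N (P i) := by
  classical
  simp only [bprob]
  rw [← bexp_sum]
  refine bexp_mono hp hp' fun S _ => ?_
  have h0 : ∀ i ∈ s, (0 : ℝ) ≤ (fun i => if P i S then (1 : ℝ) else 0) i := fun i _ => by
    dsimp only; split_ifs <;> norm_num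
  split_ifs with h
  · obtain ⟨i, hi, hPi⟩ := h
    refine le_trans ?_ (Finset.single_le_sum h0 hi)
    simp [hPi]
  · exact Finset.sum_nonneg h0

/-- Chebyshev's inequality. -/
theorem bprob_lt_abs_sub_le {p : ℝ} (hp : 0 ≤ p) (hp' : p ≤ 1) (N : Finset V) (X : Finset V → ℝ)
    (m : ℝ) {t : ℝ} (ht : 0 < t) :
    bprob p N (fun S => t < |X S - m|) ≤ bexp p N (fun S => (X S - m) ^ 2) / t ^ 2 := by
  rw [div_eq_mul_inv, ← bexp_mul_const]
  refine bexp_mono hp hp' fun S _ => ?_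
  split_ifs with h
  · rw [← div_eq_mul_inv, one_le_div (by positivity), ← sq_abs (X S - m)]
    gcongr
  · positivity

theorem bexp_pow_card (p z : ℝ) (N : Finset V) :
    bexp p N (fun S => z ^ #S) = (1 - p + p * z) ^ #N := by
  induction N using Finset.induction_on with
  | empty => simp [bexp_empty]
  | insert a N ha ih =>
    rw [bexp_insert p ha, ih, Finset.card_insert_of_notMem ha, pow_succ,
      bexp_congr (g := fun S => z * z ^ #S), bexp_const_mul, ih]
    · ring
    · intro S hS
      rw [Finset.card_insert_of_notMem fun h => ha (hS h), pow_succ]; ring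

theorem bprob_card_eq (p : ℝ) (N : Finset V) (i : ℕ) :
    bprob p N (fun S => #S = i) = (#N).choose i * p ^ i * (1 - p) ^ (#N - i) := by
  classical
  unfold bprob bexp
  simp only [mul_ite, mul_one, mul_zero]
  rw [← Finset.sum_filter, ← Finset.powersetCard_eq_filter,
    Finset.sum_congr rfl (g := fun _ => p ^ i * (1 - p) ^ (#N - i))]
  · rw [Finset.sum_const, Finset.card_powersetCard, nsmul_eq_mul, mul_assoc]
  · intro S hS
    rw [Finset.mem_powersetCard] at hS
    rw [Finset.card_sdiff_of_subset hS.1, hS.2]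

/-- Exponential Markov inequality for the binomial distribution, for both tails. -/
theorem bexp_exp_le {p : ℝ} (hp : 0 ≤ p) (hp' : p ≤ 1) (N : Finset V) {s : ℝ} (hs : |s| ≤ 1) :
    bexp p N (fun S => Real.exp (s * (#S - p * #N))) ≤ Real.exp (p * #N * s ^ 2) := by
  have h1 : bexp p N (fun S => Real.exp (s * (#S - p * #N))) =
      (1 - p + p * Real.exp s) ^ #N * Real.exp (-(s * (p * #N))) := by
    rw [← bexp_pow_card, ← bexp_mul_const]
    refine bexp_congr fun S _ => ?_
    rw [← Real.exp_nat_mul, ← Real.exp_add]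
    ring_nf
  have h2 : Real.exp s ≤ 1 + s + s ^ 2 := by
    have := (abs_le.1 (Real.abs_exp_sub_one_sub_id_le hs)).2
    linarith
  have h3 : 1 - p + p * Real.exp s ≤ Real.exp (p * (s + s ^ 2)) := by
    refine le_trans ?_ (Real.add_one_le_exp _)
    nlinarith
  have h4 : 0 ≤ 1 - p + p * Real.exp s := by
    have := Real.exp_pos s
    have : 0 ≤ p * Real.exp s := by positivity
    linarith
  rw [h1]
  calc _ ≤ Real.exp (p * (s + s ^ 2)) ^ #N * Real.exp (-(s * (p * #N))) := by gcongr
    _ = _ := by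
      rw [← Real.exp_nat_mul, ← Real.exp_add]
      ring_nf

/-- Chernoff's inequality. -/
theorem bprob_lt_abs_card_sub_le {p : ℝ} (hp : 0 ≤ p) (hp' : p ≤ 1) (N : Finset V) {τ : ℝ}
    (hτ : 0 ≤ τ) (hτ' : τ ≤ 1) :
    bprob p N (fun S => p * #N * τ < |(#S : ℝ) - p * #N|) ≤
      2 * Real.exp (-(p * #N * τ ^ 2 / 4)) := by
  -- The exponent `p #N (s² - |s| τ)` is least at `|s| = τ / 2`; the two signs of `s` serve the two
  -- tails.
  have key : ∀ s : ℝ, |s| = τ / 2 →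
      bexp p N (fun S => Real.exp (s * (#S - p * #N)) * Real.exp (-(p * #N * τ ^ 2 / 2))) ≤
        Real.exp (-(p * #N * τ ^ 2 / 4)) := by
    intro s hs
    rw [bexp_mul_const]
    have hs2 : s ^ 2 = τ ^ 2 / 4 := by rw [← sq_abs, hs]; ring
    calc _ ≤ Real.exp (p * #N * s ^ 2) * Real.exp (-(p * #N * τ ^ 2 / 2)) := by
          gcongr
          exact bexp_exp_le hp hp' N (by rw [hs]; linarith)
      _ = _ := by rw [← Real.exp_add, hs2]; ring_nf
  have k1 := key (τ / 2) (abs_of_nonneg (by positivity))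
  have k2 := key (-(τ / 2)) (by rw [abs_neg, abs_of_nonneg (by positivity)])
  rw [two_mul]
  refine le_trans ?_ (add_le_add k1 k2)
  rw [← bexp_add]
  refine bexp_mono hp hp' fun S _ => ?_
  split_ifs with h
  · have hone : ∀ s : ℝ, s * (#S - p * #N) ≥ p * #N * τ ^ 2 / 2 →
        1 ≤ Real.exp (s * (#S - p * #N)) * Real.exp (-(p * #N * τ ^ 2 / 2)) := by
      intro s hs
      rw [← Real.exp_add]
      exact Real.one_le_exp (by linarith)
    rcases lt_abs.1 h with h | h
    · have := hone (τ / 2) (by nlinarith)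
      have : 0 < Real.exp (-(τ / 2) * (#S - p * #N)) * Real.exp (-(p * #N * τ ^ 2 / 2)) := by
        positivity
      linarith
    · have := hone (-(τ / 2)) (by nlinarith)
      have : 0 < Real.exp (τ / 2 * (#S - p * #N)) * Real.exp (-(p * #N * τ ^ 2 / 2)) := by
        positivity
      linarith
  · positivity

/-- The variance of the total weight of a random subset. -/
theorem bexp_sum_sub_sq_le (p : ℝ) (N : Finset V) (w : V → ℝ) :
    bexp p N (fun S => (∑ v ∈ S, w v - p * ∑ v ∈ N, w v) ^ 2) ≤ p * ∑ v ∈ N, w v ^ 2 := by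
  have mean : ∀ N : Finset V, bexp p N (fun S => ∑ v ∈ S, w v) = p * ∑ v ∈ N, w v := by
    intro N
    induction N using Finset.induction_on with
    | empty => simp [bexp_empty]
    | insert a N ha ih =>
      rw [bexp_insert p ha, ih, Finset.sum_insert ha,
        bexp_congr (g := fun S => w a + ∑ v ∈ S, w v), bexp_add, ih, bexp_const]
      · ring
      · intro S hS
        rw [Finset.sum_insert fun h => ha (hS h)]
  induction N using Finset.induction_on with
  | empty => simp [bexp_empty]
  | insert a N ha ih =>
    rw [bexp_insert p ha, Finset.sum_insert ha, Finset.sum_insert ha]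
    -- Shifting a centred variable by `c` adds `c²` to its second moment. The shift is `-p w(a)` if
    -- `a` is dropped and `(1 - p) w(a)` if it is kept, so `a` contributes `p (1 - p) w(a)²`.
    have e : ∀ c : ℝ, bexp p N (fun S => (∑ v ∈ S, w v - p * ∑ v ∈ N, w v + c) ^ 2) =
        bexp p N (fun S => (∑ v ∈ S, w v - p * ∑ v ∈ N, w v) ^ 2) + c ^ 2 := by
      intro c
      have : (fun S : Finset V => (∑ v ∈ S, w v - p * ∑ v ∈ N, w v + c) ^ 2) =
          fun S => ((∑ v ∈ S, w v - p * ∑ v ∈ N, w v) ^ 2 + 2 * c * ∑ v ∈ S, w v) +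
            (c ^ 2 - 2 * c * (p * ∑ v ∈ N, w v)) := by
        funext S; ring
      rw [this, bexp_add, bexp_add, bexp_const_mul, bexp_const, mean]
      ring
    have e1 : bexp p N (fun S => (∑ v ∈ S, w v - p * (w a + ∑ v ∈ N, w v)) ^ 2) =
        bexp p N (fun S => (∑ v ∈ S, w v - p * ∑ v ∈ N, w v) ^ 2) + (-(p * w a)) ^ 2 := by
      rw [← e]
      exact bexp_congr fun S _ => by ring
    have e2 : bexp p N (fun S => (∑ v ∈ insert a S, w v - p * (w a + ∑ v ∈ N, w v)) ^ 2) =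
        bexp p N (fun S => (∑ v ∈ S, w v - p * ∑ v ∈ N, w v) ^ 2) + ((1 - p) * w a) ^ 2 := by
      rw [← e]
      refine bexp_congr fun S hS => ?_
      rw [Finset.sum_insert fun h => ha (hS h)]
      ring
    rw [e1, e2]
    nlinarith [sq_nonneg (p * w a)]

end BinomialSubset

/-! ### Edge switchings: edge probabilities and existence of graphs with given degrees. -/

section Switching

open Finset

variable {V : Type*} [Fintype V] [DecidableEq V]

open Classical in
/-- The neighbourhood of `v` in `G`, as a finite set. -/
noncomputable def nbr (G : SimpleGraph V) (v : V) : Finset V := {w | G.Adj v w}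

omit [DecidableEq V] in
@[simp] theorem mem_nbr {G : SimpleGraph V} {v w : V} : w ∈ nbr G v ↔ G.Adj v w := by
  simp [nbr]

open Classical in
theorem card_nbr_eq_card_incident (G : SimpleGraph V) (w : V) :
    #(nbr G w) = #{e : Sym2 V | e ∈ G.edgeSet ∧ w ∈ e} := by
  rw [← Finset.card_image_of_injective (nbr G w) (f := fun t => s(w, t))
    fun a b h => Sym2.congr_right.1 h]
  congr 1
  ext e
  induction e using Sym2.ind with
  | _ a b =>
    simp only [mem_image, mem_nbr, mem_filter, mem_univ, true_and, SimpleGraph.mem_edgeSet,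
      Sym2.mem_iff]
    constructor
    · rintro ⟨t, ht, h⟩
      rcases Sym2.eq_iff.1 h with ⟨rfl, rfl⟩ | ⟨rfl, rfl⟩
      · exact ⟨ht, Or.inl rfl⟩
      · exact ⟨ht.symm, Or.inr rfl⟩
    · rintro ⟨h, rfl | rfl⟩
      · exact ⟨b, h, rfl⟩
      · exact ⟨a, h.symm, Sym2.eq_swap⟩

/-- The graph obtained from `G` by deleting the edges in `R` and inserting those in `I`. -/
def replaceEdges (G : SimpleGraph V) (R I : Finset (Sym2 V)) : SimpleGraph V :=
  SimpleGraph.fromEdgeSet ((G.edgeSet \ R) ∪ I)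

omit [Fintype V] [DecidableEq V] in
theorem mem_edgeSet_replaceEdges {G : SimpleGraph V} {R I : Finset (Sym2 V)}
    (hI : ∀ e ∈ I, ¬ e.IsDiag) {e : Sym2 V} :
    e ∈ (replaceEdges G R I).edgeSet ↔ (e ∈ G.edgeSet ∧ e ∉ R) ∨ e ∈ I := by
  rw [replaceEdges, SimpleGraph.edgeSet_fromEdgeSet]
  simp only [Set.mem_sdiff, Set.mem_union, Finset.mem_coe]
  constructor
  · exact fun h => h.1
  · rintro (h | h)
    · exact ⟨Or.inl h, G.not_isDiag_of_mem_edgeSet h.1⟩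
    · exact ⟨Or.inr h, hI e h⟩

omit [Fintype V] [DecidableEq V] in
-- A replacement with known `R` and `I` is reversible: membership in `G` is prescribed on `R ∪ I`
-- and unchanged elsewhere. This is what makes the switching map injective.
theorem replaceEdges_inj {G G' : SimpleGraph V} {R I : Finset (Sym2 V)}
    (hI : ∀ e ∈ I, ¬ e.IsDiag) (hG : ∀ e ∈ I, e ∉ G.edgeSet) (hG' : ∀ e ∈ I, e ∉ G'.edgeSet)
    (hR : ∀ e ∈ R, e ∈ G.edgeSet) (hR' : ∀ e ∈ R, e ∈ G'.edgeSet)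
    (h : replaceEdges G R I = replaceEdges G' R I) : G = G' := by
  rw [← SimpleGraph.edgeSet_inj]
  ext e
  have key := congrArg (fun G => e ∈ SimpleGraph.edgeSet G) h
  simp only [mem_edgeSet_replaceEdges hI, eq_iff_iff] at key
  by_cases h1 : e ∈ I
  · simp [hG e h1, hG' e h1]
  by_cases h2 : e ∈ R
  · simp [hR e h2, hR' e h2]
  · simpa [h1, h2] using key

theorem card_nbr_replaceEdges {G : SimpleGraph V} {R I : Finset (Sym2 V)}
    (hI : ∀ e ∈ I, ¬ e.IsDiag) (hI' : ∀ e ∈ I, e ∉ G.edgeSet) (hR : ∀ e ∈ R, e ∈ G.edgeSet)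
    (w : V) :
    #(nbr (replaceEdges G R I) w) + #{e ∈ R | w ∈ e} = #(nbr G w) + #{e ∈ I | w ∈ e} := by
  classical
  rw [card_nbr_eq_card_incident, card_nbr_eq_card_incident, ← Finset.card_union_of_disjoint,
    ← Finset.card_union_of_disjoint]
  · congr 1
    ext e
    simp only [mem_union, mem_filter, mem_univ, true_and, mem_edgeSet_replaceEdges hI]
    have := hR e
    tauto
  · rw [Finset.disjoint_left]
    intro e he he'
    simp only [mem_filter, mem_univ, true_and] at he he'
    exact hI' e he'.1 he.1
  · rw [Finset.disjoint_left]
    intro e he he'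
    simp only [mem_filter, mem_univ, true_and, mem_edgeSet_replaceEdges hI] at he he'
    rcases he.1 with h | h
    · exact h.2 he'.1
    · exact hI' e h (hR e he'.1)

omit [Fintype V] in
theorem card_filter_mem_pair {u v x y : V} (huv : u ≠ v) (hxy : x ≠ y) (h : s(u, v) ≠ s(x, y))
    (w : V) : #{e ∈ ({s(u, v), s(x, y)} : Finset (Sym2 V)) | w ∈ e} =
      (if w = u then 1 else 0) + (if w = v then 1 else 0) +
        ((if w = x then 1 else 0) + (if w = y then 1 else 0)) := by
  have aux : ∀ {a b : V}, a ≠ b → (if w ∈ s(a, b) then 1 else 0) =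
      (if w = a then 1 else 0) + (if w = b then 1 else 0) := by
    intro a b hab
    simp only [Sym2.mem_iff]
    by_cases h1 : w = a
    · subst h1; simp [hab]
    · simp [h1]
  rw [Finset.card_filter, Finset.sum_pair h, aux huv, aux hxy]

open Classical in
/-- Ordered edges `(x, y)` of `G` that can be switched against `(u, v)`, avoiding the edges
in `H`. -/
noncomputable def switchable (G : SimpleGraph V) (H : Finset (Sym2 V)) (u v : V) :
    Finset (Σ _ : V, V) :=
  {q ∈ Finset.univ.sigma (nbr G) |
    q.1 ∉ insert u (nbr G u) ∧ q.2 ∉ insert v (nbr G v) ∧ s(q.1, q.2) ∉ H}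

theorem mem_switchable {G : SimpleGraph V} {H : Finset (Sym2 V)} {u v x y : V} :
    (⟨x, y⟩ : Σ _ : V, V) ∈ switchable G H u v ↔
      G.Adj x y ∧ (x ≠ u ∧ ¬ G.Adj u x) ∧ (y ≠ v ∧ ¬ G.Adj v y) ∧ s(x, y) ∉ H := by
  simp [switchable]

/-- An ordered edge `(x, y)` fails to be switchable only if `x` is in the closed neighbourhood of
`u`, or `y` in that of `v` (at most `D (D + 1)` each), or `xy` is in `H` (two orientations). -/
theorem sum_card_nbr_le_card_switchable {G : SimpleGraph V} {D : ℕ} (hD : ∀ v, #(nbr G v) ≤ D)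
    (H : Finset (Sym2 V)) (u v : V) :
    ∑ w, #(nbr G w) ≤ #(switchable G H u v) + 2 * (D * (D + 1)) + 2 * #H := by
  classical
  have hins : ∀ w, #(insert w (nbr G w)) ≤ D + 1 := fun w =>
    (Finset.card_insert_le _ _).trans (Nat.succ_le_succ (hD w))
  let B1 : Finset (Σ _ : V, V) := (insert u (nbr G u)).sigma (nbr G)
  let B2 : Finset (Σ _ : V, V) :=
    (insert v (nbr G v)).biUnion fun y => (nbr G y).image fun x => ⟨x, y⟩
  let B3 : Finset (Σ _ : V, V) := H.biUnion fun e => {q | s(q.1, q.2) = e}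
  have h1 : #B1 ≤ D * (D + 1) := by
    rw [Finset.card_sigma, mul_comm]
    refine (Finset.sum_le_card_nsmul _ _ D fun x _ => hD x).trans ?_
    rw [smul_eq_mul]
    exact Nat.mul_le_mul_right _ (hins u)
  have h2 : #B2 ≤ D * (D + 1) := by
    rw [mul_comm]
    refine (Finset.card_biUnion_le_card_mul _ _ D fun x _ =>
      Finset.card_image_le.trans (hD x)).trans ?_
    exact Nat.mul_le_mul_right _ (hins v)
  have h3 : #B3 ≤ 2 * #H := by
    rw [mul_comm]
    refine Finset.card_biUnion_le_card_mul _ _ 2 fun e _ => ?_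
    induction e using Sym2.ind with
    | _ a b =>
      refine (Finset.card_le_card (t := {⟨a, b⟩, ⟨b, a⟩}) fun q hq => ?_).trans
        (Finset.card_le_two)
      obtain ⟨x, y⟩ := q
      simp only [mem_filter, mem_univ, true_and, Sym2.eq_iff] at hq
      rcases hq with ⟨rfl, rfl⟩ | ⟨rfl, rfl⟩ <;> simp
  have hsub : Finset.univ.sigma (nbr G) ⊆ switchable G H u v ∪ (B1 ∪ (B2 ∪ B3)) := by
    rintro ⟨x, y⟩ hq
    have hxy : G.Adj x y := by simpa using hq
    by_cases hx : x ∈ insert u (nbr G u)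
    · have : (⟨x, y⟩ : Σ _ : V, V) ∈ B1 := Finset.mem_sigma.2 ⟨hx, mem_nbr.2 hxy⟩
      simp [this]
    by_cases hy : y ∈ insert v (nbr G v)
    · have : (⟨x, y⟩ : Σ _ : V, V) ∈ B2 :=
        Finset.mem_biUnion.2 ⟨y, hy, Finset.mem_image.2 ⟨x, mem_nbr.2 hxy.symm, rfl⟩⟩
      simp [this]
    by_cases hH : s(x, y) ∈ H
    · have : (⟨x, y⟩ : Σ _ : V, V) ∈ B3 := Finset.mem_biUnion.2 ⟨_, hH, by simp⟩
      simp [this]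
    · refine Finset.mem_union_left _ (mem_switchable.2 ⟨hxy, ?_, ?_, hH⟩)
      · simpa using hx
      · simpa using hy
  have := Finset.card_le_card hsub
  rw [Finset.card_sigma] at this
  have := Finset.card_union_le (switchable G H u v) (B1 ∪ (B2 ∪ B3))
  have := Finset.card_union_le B1 (B2 ∪ B3)
  have := Finset.card_union_le B2 B3
  omega

open Classical in
/-- The graphs on `V` in which each vertex `v` has degree `d v`. -/
noncomputable def degreeFamily (d : V → ℕ) : Finset (SimpleGraph V) :=
  {G | ∀ v, #(nbr G v) = d v}

theorem mem_degreeFamily {d : V → ℕ} {G : SimpleGraph V} :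
    G ∈ degreeFamily d ↔ ∀ v, #(nbr G v) = d v := by
  simp [degreeFamily]

open Classical in
/-- The graphs with degrees `d` that contain all the edges in `H`. -/
noncomputable def degreeFamilyContaining (d : V → ℕ) (H : Finset (Sym2 V)) :
    Finset (SimpleGraph V) :=
  {G ∈ degreeFamily d | ∀ e ∈ H, e ∈ G.edgeSet}

theorem mem_degreeFamilyContaining {d : V → ℕ} {H : Finset (Sym2 V)} {G : SimpleGraph V} :
    G ∈ degreeFamilyContaining d H ↔ G ∈ degreeFamily d ∧ ∀ e ∈ H, e ∈ G.edgeSet := by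
  simp [degreeFamilyContaining]

/-- Given that a random graph with degrees `d` contains `H`, it contains a further edge `uv` with
probability at most `2 d(u) d(v) / M`. -/
theorem card_degreeFamilyContaining_insert_le {d : V → ℕ} {D : ℕ} (hD : ∀ v, d v ≤ D)
    {H : Finset (Sym2 V)} (hM : 4 * (D * (D + 1)) + 4 * #H ≤ ∑ w, d w) {u v : V}
    (huv : s(u, v) ∉ H) :
    (∑ w, d w) * #(degreeFamilyContaining d (insert s(u, v) H)) ≤
      2 * (d u * d v) * #(degreeFamilyContaining d H) := by
  classical
  set 𝒜 := degreeFamilyContaining d (insert s(u, v) H) with h𝒜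
  set ℬ := degreeFamilyContaining d H with hℬ
  have hA : ∀ G ∈ 𝒜, (∀ w, #(nbr G w) = d w) ∧ G.Adj u v ∧ ∀ e ∈ H, e ∈ G.edgeSet := by
    intro G hG
    rw [h𝒜, mem_degreeFamilyContaining, mem_degreeFamily] at hG
    exact ⟨hG.1, hG.2 _ (Finset.mem_insert_self _ _),
      fun e he => hG.2 e (Finset.mem_insert_of_mem he)⟩
  -- By `hM`, at most half of the ordered edges are not switchable.
  have hlow : ∀ G ∈ 𝒜, ∑ w, d w ≤ 2 * #(switchable G H u v) := by
    intro G hG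
    obtain ⟨hdeg, -, -⟩ := hA G hG
    have := sum_card_nbr_le_card_switchable (G := G) (fun v => (hdeg v).trans_le (hD v)) H u v
    simp only [hdeg] at this
    omega
  -- Double counting: trade `uv, xy` for `ux, vy` and remember `(x, y)`. In the new graph `x` is a
  -- neighbour of `u` and `y` one of `v`, so each graph of `ℬ` occurs with at most `d u * d v`
  -- pairs.
  let φ : (Σ _ : SimpleGraph V, Σ _ : V, V) → (Σ _ : SimpleGraph V, Σ _ : V, V) := fun q =>
    ⟨replaceEdges q.1 {s(u, v), s(q.2.1, q.2.2)} {s(u, q.2.1), s(v, q.2.2)}, q.2⟩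
  -- the facts about a switching that are used for both of its properties
  have hsw : ∀ G ∈ 𝒜, ∀ x y, (⟨x, y⟩ : Σ _ : V, V) ∈ switchable G H u v →
      (∀ e ∈ ({s(u, x), s(v, y)} : Finset (Sym2 V)), ¬ e.IsDiag) ∧
      (∀ e ∈ ({s(u, x), s(v, y)} : Finset (Sym2 V)), e ∉ G.edgeSet) ∧
      (∀ e ∈ ({s(u, v), s(x, y)} : Finset (Sym2 V)), e ∈ G.edgeSet) := by
    intro G hG x y hq
    obtain ⟨-, huvG, -⟩ := hA G hG
    obtain ⟨hxy, ⟨hxu, hux⟩, ⟨hyv, hvy⟩, -⟩ := mem_switchable.1 hq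
    refine ⟨?_, ?_, ?_⟩ <;> intro e he <;> simp only [mem_insert, mem_singleton] at he <;>
      rcases he with rfl | rfl
    · simpa using Ne.symm hxu
    · simpa using Ne.symm hyv
    · simpa using hux
    · simpa using hvy
    · simpa using huvG
    · simpa using hxy
  have hcard : #(𝒜.sigma fun G => switchable G H u v) ≤
      #(ℬ.sigma fun G => (nbr G u).sigma fun _ => nbr G v) := by
    refine Finset.card_le_card_of_injOn φ ?_ ?_
    · rintro ⟨G, x, y⟩ hq
      obtain ⟨hG, hq⟩ := Finset.mem_sigma.1 hq
      dsimp only at hG hq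
      obtain ⟨hI, hI', hR⟩ := hsw G hG x y hq
      obtain ⟨hdeg, huvG, hH⟩ := hA G hG
      obtain ⟨hxy, ⟨hxu, hux⟩, ⟨hyv, hvy⟩, hxyH⟩ := mem_switchable.1 hq
      have hne1 : s(u, v) ≠ s(x, y) := by
        intro h
        rcases Sym2.eq_iff.1 h with ⟨h1, h2⟩ | ⟨h1, h2⟩
        · exact hxu h1.symm
        · exact hux (h2 ▸ huvG)
      have hne2 : s(u, x) ≠ s(v, y) := by
        intro h
        rcases Sym2.eq_iff.1 h with ⟨h1, h2⟩ | ⟨h1, h2⟩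
        · exact huvG.ne h1
        · exact hux (h2 ▸ huvG)
      simp only [φ, Finset.coe_sigma, Set.mem_sigma_iff, Finset.mem_coe, mem_nbr]
      refine ⟨mem_degreeFamilyContaining.2 ⟨mem_degreeFamily.2 fun w => ?_, fun e he => ?_⟩,
        ?_, ?_⟩
      · have := card_nbr_replaceEdges hI hI' hR w
        rw [card_filter_mem_pair huvG.ne hxy.ne hne1,
          card_filter_mem_pair (Ne.symm hxu) (Ne.symm hyv) hne2] at this
        rw [← hdeg w]
        omega
      · rw [mem_edgeSet_replaceEdges hI]
        refine Or.inl ⟨hH e he, ?_⟩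
        simp only [mem_insert, mem_singleton, not_or]
        exact ⟨fun h => huv (h ▸ he), fun h => hxyH (h ▸ he)⟩
      · rw [← SimpleGraph.mem_edgeSet, mem_edgeSet_replaceEdges hI]
        simp
      · rw [← SimpleGraph.mem_edgeSet, mem_edgeSet_replaceEdges hI]
        simp
    · rintro ⟨G, x, y⟩ hq ⟨G', x', y'⟩ hq' h
      simp only [Finset.coe_sigma, Set.mem_sigma_iff, Finset.mem_coe] at hq hq'
      simp only [φ, Sigma.mk.injEq, heq_eq_eq] at h
      obtain ⟨h, rfl, rfl⟩ := h
      obtain ⟨hI, hI', hR⟩ := hsw G hq.1 x y hq.2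
      obtain ⟨-, hI2, hR2⟩ := hsw G' hq'.1 x y hq'.2
      rw [replaceEdges_inj hI hI' hI2 hR hR2 h]
  rw [Finset.card_sigma, Finset.card_sigma] at hcard
  have h1 : (∑ w, d w) * #𝒜 ≤ 2 * ∑ G ∈ 𝒜, #(switchable G H u v) := by
    rw [mul_comm, ← smul_eq_mul, Finset.mul_sum 𝒜]
    exact Finset.card_nsmul_le_sum _ _ _ hlow
  have h2 : ∑ G ∈ ℬ, #((nbr G u).sigma fun _ => nbr G v) = #ℬ * (d u * d v) := by
    rw [Finset.sum_const_nat]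
    intro G hG
    rw [hℬ, mem_degreeFamilyContaining, mem_degreeFamily] at hG
    simp [hG.1]
  rw [h2] at hcard
  nlinarith

omit [DecidableEq V] in
theorem even_sum_card_nbr (G : SimpleGraph V) : Even (∑ v, #(nbr G v)) := by
  classical
  have : ∀ v, #(nbr G v) = G.degree v := by
    intro v
    rw [← SimpleGraph.card_neighborFinset_eq_degree]
    congr 1
    ext w
    simp
  simp only [this, SimpleGraph.sum_degrees_eq_twice_card_edges]
  exact even_two_mul _

/-- A sequence with even sum whose maximum is small compared with its sum is graphic. -/
theorem degreeFamily_nonempty {d : V → ℕ} {D : ℕ} (hD : ∀ v, d v ≤ D)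
    (heven : Even (∑ v, d v)) (hM : 3 * (D * (D + 1)) < ∑ v, d v) :
    (degreeFamily d).Nonempty := by
  classical
  -- Extremal choice: among graphs with degrees at most `d`, one with the most edges. A vertex with
  -- degree missing leads to a graph with more edges.
  obtain ⟨G, hG, hmax⟩ := Finset.exists_max_image
    (Finset.univ.filter fun G : SimpleGraph V => ∀ v, #(nbr G v) ≤ d v)
    (fun G => ∑ v, #(nbr G v)) ⟨⊥, by
      rw [Finset.mem_filter]
      exact ⟨Finset.mem_univ _, fun v => by simp [nbr]⟩⟩
  simp only [mem_filter, mem_univ, true_and] at hG hmax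
  by_contra hne
  have hnot : ∃ u, #(nbr G u) < d u := by
    by_contra! h
    exact hne ⟨G, mem_degreeFamily.2 fun v => le_antisymm (hG v) (h v)⟩
  obtain ⟨u, hu⟩ := hnot
  -- Two units of degree are missing, at `u` and `v`. If no vertex but `u` is deficient, parity
  -- makes the deficiency of `u` at least two, and `v = u`.
  have hdef : ∃ v, ∀ w, #(nbr G w) + (if w = u then 1 else 0) + (if w = v then 1 else 0) ≤ d w := by
    by_cases h : ∃ v, v ≠ u ∧ #(nbr G v) < d v
    · obtain ⟨v, hvu, hv⟩ := h
      refine ⟨v, fun w => ?_⟩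
      have := hG w
      by_cases h1 : w = u
      · subst h1
        simpa [Ne.symm hvu] using hu
      · by_cases h2 : w = v
        · subst h2
          simpa [h1] using hv
        · simpa [h1, h2] using this
    · push Not at h
      refine ⟨u, fun w => ?_⟩
      by_cases h1 : w = u
      · subst h1
        have e1 := Finset.sum_erase_add Finset.univ d (Finset.mem_univ w)
        have e2 := Finset.sum_erase_add Finset.univ (fun v => #(nbr G v)) (Finset.mem_univ w)
        have e3 : ∑ v ∈ Finset.univ.erase w, d v = ∑ v ∈ Finset.univ.erase w, #(nbr G v) :=
          Finset.sum_congr rfl fun v hv => le_antisymm (h v (Finset.ne_of_mem_erase hv)) (hG v)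
        have e4 := even_sum_card_nbr G
        rw [Nat.even_iff] at heven e4
        simp only [if_true]
        omega
      · simpa [h1] using hG w
  obtain ⟨v, hv⟩ := hdef
  -- Otherwise the edge `uw` could be added. Hence all missing degree lies in the closed
  -- neighbourhood of `u`, at most `D (D + 1)` in total.
  have hclique : ∀ w, w ≠ u → #(nbr G w) < d w → G.Adj u w := by
    intro w hwu hw
    by_contra hadj
    have hI : ∀ e ∈ ({s(u, w)} : Finset (Sym2 V)), ¬ e.IsDiag := by
      simpa using Ne.symm hwu
    have hI' : ∀ e ∈ ({s(u, w)} : Finset (Sym2 V)), e ∉ G.edgeSet := by simpa using hadj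
    have hcard := card_nbr_replaceEdges (R := ∅) hI hI' (by simp)
    simp only [Finset.filter_empty, Finset.card_empty, add_zero] at hcard
    have h1 : ∀ t, #(nbr (replaceEdges G ∅ {s(u, w)}) t) ≤ d t := by
      intro t
      rw [hcard t, Finset.card_filter, Finset.sum_singleton]
      simp only [Sym2.mem_iff]
      have := hG t
      by_cases h1 : t = u
      · subst h1; simp; omega
      · by_cases h2 : t = w
        · subst h2; simp; omega
        · simpa [h1, h2] using this
    have h2 := hmax _ h1
    have h3 : ∑ t, #(nbr G t) < ∑ t, #(nbr (replaceEdges G ∅ {s(u, w)}) t) := by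
      refine Finset.sum_lt_sum (fun t _ => by rw [hcard t]; omega) ⟨u, Finset.mem_univ _, ?_⟩
      rw [hcard u, Finset.card_filter, Finset.sum_singleton]
      simp
    omega
  have hsum : ∑ w, d w ≤ ∑ w, #(nbr G w) + D * (D + 1) := by
    have h1 : ∀ w, d w ≤ #(nbr G w) + if w ∈ insert u (nbr G u) then D else 0 := by
      intro w
      split_ifs with h
      · have := hD w; omega
      · rw [Finset.mem_insert, mem_nbr, not_or] at h
        by_contra hlt
        exact h.2 (hclique w h.1 (by omega))
    refine (Finset.sum_le_sum fun w _ => h1 w).trans ?_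
    rw [Finset.sum_add_distrib]
    refine Nat.add_le_add_left ?_ _
    rw [Finset.sum_ite_mem, Finset.univ_inter, Finset.sum_const, smul_eq_mul, mul_comm]
    have := (Finset.card_insert_le u (nbr G u)).trans
      (Nat.succ_le_succ ((hG u).trans (hD u)))
    exact Nat.mul_le_mul_left _ this
  -- Of the `3 D (D + 1)` in `hM`, one third pays for the missing degree and two thirds for the
  -- non-switchable edges. Replacing a switchable `xy` by `ux, vy` then raises the degrees of `u`
  -- and `v` only.
  have hgood : (switchable G ∅ u v).Nonempty := by
    rw [← Finset.card_pos]
    have := sum_card_nbr_le_card_switchable (G := G) (fun v => (hG v).trans (hD v)) ∅ u v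
    simp only [Finset.card_empty] at this
    omega
  obtain ⟨⟨x, y⟩, hq⟩ := hgood
  obtain ⟨hxy, ⟨hxu, hux⟩, ⟨hyv, hvy⟩, -⟩ := mem_switchable.1 hq
  have hne : s(u, x) ≠ s(v, y) := by
    intro h
    rcases Sym2.eq_iff.1 h with ⟨h1, h2⟩ | ⟨h1, h2⟩
    · exact hxy.ne h2
    · subst h2
      refine hux (hclique x hxu ?_)
      have := hv x
      simp only [if_true] at this
      omega
  have hI : ∀ e ∈ ({s(u, x), s(v, y)} : Finset (Sym2 V)), ¬ e.IsDiag := by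
    simpa using ⟨Ne.symm hxu, Ne.symm hyv⟩
  have hI' : ∀ e ∈ ({s(u, x), s(v, y)} : Finset (Sym2 V)), e ∉ G.edgeSet := by
    simpa using ⟨hux, hvy⟩
  have hR : ∀ e ∈ ({s(x, y)} : Finset (Sym2 V)), e ∈ G.edgeSet := by simpa using hxy
  have hcard : ∀ w, #(nbr (replaceEdges G {s(x, y)} {s(u, x), s(v, y)}) w) =
      #(nbr G w) + (if w = u then 1 else 0) + (if w = v then 1 else 0) := by
    intro w
    have := card_nbr_replaceEdges hI hI' hR w
    rw [card_filter_mem_pair (Ne.symm hxu) (Ne.symm hyv) hne, Finset.card_filter,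
      Finset.sum_singleton] at this
    have hmem : (if w ∈ s(x, y) then 1 else 0) =
        (if w = x then 1 else 0) + (if w = y then 1 else 0) := by
      by_cases h1 : w = x
      · subst h1; simp [hxy.ne]
      · simp [h1]
    rw [hmem] at this
    omega
  have h2 := hmax _ fun w => (hcard w).trans_le (hv w)
  have h3 : ∑ t, #(nbr G t) < ∑ t, #(nbr (replaceEdges G {s(x, y)} {s(u, x), s(v, y)}) t) := by
    refine Finset.sum_lt_sum (fun t _ => by rw [hcard t]; omega) ⟨u, Finset.mem_univ _, ?_⟩
    rw [hcard u]
    simp only [if_true]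
    omega
  omega

end Switching

/-! ### Second moment of the number of vertices with `i` retained neighbours. -/

section SecondMoment

open Finset

variable {V : Type*} [Fintype V] [DecidableEq V]

open Classical in
/-- The indicator of an edge of `G`. -/
noncomputable def adjInd (G : SimpleGraph V) (u v : V) : ℝ := if G.Adj u v then 1 else 0

omit [Fintype V] [DecidableEq V] in
theorem adjInd_nonneg (G : SimpleGraph V) (u v : V) : 0 ≤ adjInd G u v := by
  unfold adjInd; split_ifs <;> norm_num

omit [Fintype V] [DecidableEq V] in
@[simp] theorem adjInd_self (G : SimpleGraph V) (u : V) : adjInd G u u = 0 := by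
  simp [adjInd]

/-- The switching bound is applied once per edge. At most three edges are already prescribed each
time, so the slack 16 in `hM` covers the term `4 * #H`. -/
theorem card_degreeFamilyContaining_list_le {d : V → ℕ} {D : ℕ} (hD : ∀ v, d v ≤ D)
    (hM : 4 * (D * (D + 1)) + 16 ≤ ∑ w, d w) (l : List (V × V)) (hl : l.length ≤ 4)
    (hnd : (l.map fun q => s(q.1, q.2)).Nodup) :
    (#(degreeFamilyContaining d (l.map fun q => s(q.1, q.2)).toFinset) : ℝ) ≤
      (l.map fun q => 2 * ((d q.1 : ℝ) * d q.2) / (∑ w, d w : ℕ)).prod *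
        #(degreeFamily d) := by
  induction l with
  | nil => simp [degreeFamilyContaining]
  | cons q l ih =>
    rw [List.map_cons, List.nodup_cons] at hnd
    rw [List.length_cons] at hl
    have ih := ih (by omega) hnd.2
    have hH : #(l.map fun q => s(q.1, q.2)).toFinset ≤ 3 :=
      (List.toFinset_card_le _).trans (by rw [List.length_map]; omega)
    have key := card_degreeFamilyContaining_insert_le hD (u := q.1) (v := q.2)
      (H := (l.map fun q => s(q.1, q.2)).toFinset) (by omega) (by simpa using hnd.1)
    rw [List.map_cons, List.toFinset_cons, List.map_cons, List.prod_cons]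
    have hMpos : (0 : ℝ) < (∑ w, d w : ℕ) := by
      have : 0 < ∑ w, d w := by omega
      exact_mod_cast this
    have key' : ((∑ w, d w : ℕ) : ℝ) * #(degreeFamilyContaining d
        (insert s(q.1, q.2) (l.map fun q => s(q.1, q.2)).toFinset)) ≤
        2 * ((d q.1 : ℝ) * d q.2) *
          #(degreeFamilyContaining d (l.map fun q => s(q.1, q.2)).toFinset) := by
      exact_mod_cast key
    rw [mul_comm, ← le_div_iff₀ hMpos] at key'
    refine key'.trans ?_
    rw [mul_div_right_comm, mul_assoc]
    exact mul_le_mul_of_nonneg_left ih (by positivity)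

theorem sum_prod_adjInd_le {d : V → ℕ} {D : ℕ} (hD : ∀ v, d v ≤ D)
    (hM : 4 * (D * (D + 1)) + 16 ≤ ∑ w, d w) (l : List (V × V)) (hl : l.length ≤ 4)
    (hnd : (l.map fun q => s(q.1, q.2)).Nodup) :
    ∑ G ∈ degreeFamily d, (l.map fun q => adjInd G q.1 q.2).prod ≤
      (l.map fun q => 2 * ((d q.1 : ℝ) * d q.2) / (∑ w, d w : ℕ)).prod *
        #(degreeFamily d) := by
  classical
  refine le_trans (le_of_eq ?_) (card_degreeFamilyContaining_list_le hD hM l hl hnd)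
  rw [degreeFamilyContaining, Finset.card_filter, Nat.cast_sum]
  refine Finset.sum_congr rfl fun G _ => ?_
  clear hl hnd
  induction l with
  | nil => simp
  | cons q l ih =>
    rw [List.map_cons, List.prod_cons, ih]
    by_cases h : G.Adj q.1 q.2
    · simp [adjInd, h]
    · simp [adjInd, h]

theorem sum_adjInd_le {d : V → ℕ} {D : ℕ} (hD : ∀ v, d v ≤ D)
    (hM : 4 * (D * (D + 1)) + 16 ≤ ∑ w, d w) {c : ℝ} {u v : V} (hu : d u ≤ c) (hv : d v ≤ c) :
    ∑ G ∈ degreeFamily d, adjInd G u v ≤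
      2 * c ^ 2 / (∑ w, d w : ℕ) * #(degreeFamily d) := by
  have h := sum_prod_adjInd_le hD hM [(u, v)] (by simp) (by simp)
  simp only [List.map_cons, List.map_nil, List.prod_cons, List.prod_nil, mul_one] at h
  refine h.trans ?_
  have : (d u : ℝ) * d v ≤ c ^ 2 := by
    rw [sq]; exact mul_le_mul hu hv (Nat.cast_nonneg _) ((Nat.cast_nonneg _).trans hu)
  gcongr

omit [DecidableEq V] in
theorem sum_sq_le_mul_sum {d : V → ℕ} {D : ℕ} (hD : ∀ v, d v ≤ D) :
    ∑ x, (d x : ℝ) ^ 2 ≤ D * (∑ w, d w : ℕ) := by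
  rw [Nat.cast_sum, Finset.mul_sum]
  refine Finset.sum_le_sum fun x _ => ?_
  rw [sq]
  have : (d x : ℝ) ≤ D := by exact_mod_cast hD x
  gcongr

/-- Only `u` and `v` have degree at most `c`. The middle vertex is arbitrary and enters through `∑
d(x)² ≤ D M`, which costs one factor `D` and gains back one factor `M`; likewise in the next two
bounds. -/
theorem sum_common_le {d : V → ℕ} {D : ℕ} (hD : ∀ v, d v ≤ D)
    (hM : 4 * (D * (D + 1)) + 16 ≤ ∑ w, d w) {c : ℝ} {u v : V} (hu : d u ≤ c) (hv : d v ≤ c)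
    (huv : u ≠ v) :
    ∑ G ∈ degreeFamily d, ∑ x, adjInd G u x * adjInd G v x ≤
      4 * c ^ 2 * D / (∑ w, d w : ℕ) * #(degreeFamily d) := by
  rw [Finset.sum_comm]
  set M : ℝ := ((∑ w, d w : ℕ) : ℝ) with hMdef
  have hMpos : (0 : ℝ) < M := by
    have : 0 < ∑ w, d w := by omega
    rw [hMdef]; exact_mod_cast this
  have hc : (d u : ℝ) * d v ≤ c ^ 2 := by
    rw [sq]; exact mul_le_mul hu hv (Nat.cast_nonneg _) ((Nat.cast_nonneg _).trans hu)
  have h : ∀ x, ∑ G ∈ degreeFamily d, adjInd G u x * adjInd G v x ≤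
      4 * c ^ 2 / M ^ 2 * #(degreeFamily d) * (d x : ℝ) ^ 2 := by
    intro x
    have h := sum_prod_adjInd_le hD hM [(u, x), (v, x)] (by simp) (by simp; grind)
    simp only [List.map_cons, List.map_nil, List.prod_cons, List.prod_nil, mul_one] at h
    refine h.trans ?_
    rw [← hMdef]
    calc _ = 4 * ((d u : ℝ) * d v) / M ^ 2 * #(degreeFamily d) * (d x : ℝ) ^ 2 := by
          field_simp; ring
      _ ≤ _ := by gcongr
  refine (Finset.sum_le_sum fun x _ => h x).trans ?_
  rw [← Finset.mul_sum]
  calc _ ≤ 4 * c ^ 2 / M ^ 2 * #(degreeFamily d) * (D * M) := by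
        gcongr
        exact sum_sq_le_mul_sum hD
    _ = _ := by field_simp

theorem sum_adj_common_le {d : V → ℕ} {D : ℕ} (hD : ∀ v, d v ≤ D)
    (hM : 4 * (D * (D + 1)) + 16 ≤ ∑ w, d w) {c : ℝ} {u v : V} (hu : d u ≤ c) (hv : d v ≤ c)
    (huv : u ≠ v) :
    ∑ G ∈ degreeFamily d, adjInd G u v * ∑ x, adjInd G u x * adjInd G v x ≤
      8 * c ^ 4 * D / (∑ w, d w : ℕ) ^ 2 * #(degreeFamily d) := by
  simp only [Finset.mul_sum]
  rw [Finset.sum_comm]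
  set M : ℝ := ((∑ w, d w : ℕ) : ℝ) with hMdef
  have hMpos : (0 : ℝ) < M := by
    have : 0 < ∑ w, d w := by omega
    rw [hMdef]; exact_mod_cast this
  have hc : (d u : ℝ) * d v ≤ c ^ 2 := by
    rw [sq]; exact mul_le_mul hu hv (Nat.cast_nonneg _) ((Nat.cast_nonneg _).trans hu)
  have hc4 : ((d u : ℝ) * d v) ^ 2 ≤ c ^ 4 := by
    rw [show c ^ 4 = (c ^ 2) ^ 2 by ring]; gcongr
  have h : ∀ x, ∑ G ∈ degreeFamily d, adjInd G u v * (adjInd G u x * adjInd G v x) ≤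
      8 * c ^ 4 / M ^ 3 * #(degreeFamily d) * (d x : ℝ) ^ 2 := by
    intro x
    -- For `x = u` or `x = v` the three pairs are not distinct, but then a loop indicator makes the
    -- product vanish.
    by_cases hxu : x = u
    · subst hxu
      simp only [adjInd_self, zero_mul, mul_zero, Finset.sum_const_zero]
      positivity
    by_cases hxv : x = v
    · subst hxv
      simp only [adjInd_self, mul_zero, Finset.sum_const_zero]
      positivity
    have h := sum_prod_adjInd_le hD hM [(u, v), (u, x), (v, x)] (by simp) (by simp; grind)
    simp only [List.map_cons, List.map_nil, List.prod_cons, List.prod_nil, mul_one] at h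
    refine h.trans ?_
    rw [← hMdef]
    calc _ = 8 * ((d u : ℝ) * d v) ^ 2 / M ^ 3 * #(degreeFamily d) * (d x : ℝ) ^ 2 := by
          field_simp; ring
      _ ≤ _ := by gcongr
  refine (Finset.sum_le_sum fun x _ => h x).trans ?_
  rw [← Finset.mul_sum]
  calc _ ≤ 8 * c ^ 4 / M ^ 3 * #(degreeFamily d) * (D * M) := by
        gcongr
        exact sum_sq_le_mul_sum hD
    _ = _ := by field_simp

theorem sum_two_common_le {d : V → ℕ} {D : ℕ} (hD : ∀ v, d v ≤ D)
    (hM : 4 * (D * (D + 1)) + 16 ≤ ∑ w, d w) {c : ℝ} {u v : V} (hu : d u ≤ c) (hv : d v ≤ c)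
    (huv : u ≠ v) :
    ∑ G ∈ degreeFamily d, ∑ x, ∑ y ∈ Finset.univ.erase x,
        adjInd G u x * adjInd G v x * (adjInd G u y * adjInd G v y) ≤
      16 * c ^ 4 * D ^ 2 / (∑ w, d w : ℕ) ^ 2 * #(degreeFamily d) := by
  rw [Finset.sum_comm]
  set M : ℝ := ((∑ w, d w : ℕ) : ℝ) with hMdef
  have hMpos : (0 : ℝ) < M := by
    have : 0 < ∑ w, d w := by omega
    rw [hMdef]; exact_mod_cast this
  have hc : (d u : ℝ) * d v ≤ c ^ 2 := by
    rw [sq]; exact mul_le_mul hu hv (Nat.cast_nonneg _) ((Nat.cast_nonneg _).trans hu)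
  have hc4 : ((d u : ℝ) * d v) ^ 2 ≤ c ^ 4 := by
    rw [show c ^ 4 = (c ^ 2) ^ 2 by ring]; gcongr
  have h : ∀ x y, y ≠ x →
      ∑ G ∈ degreeFamily d, adjInd G u x * adjInd G v x * (adjInd G u y * adjInd G v y) ≤
      16 * c ^ 4 / M ^ 4 * #(degreeFamily d) * ((d x : ℝ) ^ 2 * (d y : ℝ) ^ 2) := by
    intro x y hxy
    -- For `x = u` or `x = v` two of the four pairs may coincide, but a loop factor vanishes.
    by_cases hxu : x = u
    · subst hxu
      simp only [adjInd_self, zero_mul, Finset.sum_const_zero]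
      positivity
    by_cases hxv : x = v
    · subst hxv
      simp only [adjInd_self, mul_zero, zero_mul, Finset.sum_const_zero]
      positivity
    have h := sum_prod_adjInd_le hD hM [(u, x), (v, x), (u, y), (v, y)] (by simp)
      (by simp; grind)
    simp only [List.map_cons, List.map_nil, List.prod_cons, List.prod_nil, mul_one,
      ← mul_assoc] at h
    simp only [← mul_assoc]
    refine h.trans ?_
    rw [← hMdef]
    calc _ = 16 * ((d u : ℝ) * d v) ^ 2 / M ^ 4 * #(degreeFamily d) *
            ((d x : ℝ) ^ 2 * (d y : ℝ) ^ 2) := by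
          field_simp; ring
      _ ≤ 16 * c ^ 4 / M ^ 4 * #(degreeFamily d) * ((d x : ℝ) ^ 2 * (d y : ℝ) ^ 2) := by gcongr
      _ = _ := by ring
  calc _ ≤ ∑ x, ∑ y, 16 * c ^ 4 / M ^ 4 * #(degreeFamily d) *
        ((d x : ℝ) ^ 2 * (d y : ℝ) ^ 2) := by
        refine Finset.sum_le_sum fun x _ => ?_
        rw [Finset.sum_comm]
        refine (Finset.sum_le_sum fun y hy => h x y (Finset.ne_of_mem_erase hy)).trans ?_
        exact Finset.sum_le_univ_sum_of_nonneg fun y => by positivity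
    _ = 16 * c ^ 4 / M ^ 4 * #(degreeFamily d) * ((∑ x, (d x : ℝ) ^ 2) * ∑ y, (d y : ℝ) ^ 2) := by
        simp only [← Finset.mul_sum, ← Finset.sum_mul]
    _ ≤ 16 * c ^ 4 / M ^ 4 * #(degreeFamily d) * ((D * M) * (D * M)) := by
        gcongr <;> exact sum_sq_le_mul_sum hD
    _ = _ := by field_simp

open Classical in
/-- The indicator of the event that `u` lies in `S` and has exactly `i` neighbours in `S`. -/
noncomputable def hitInd (G : SimpleGraph V) (i : ℕ) (u : V) (S : Finset V) : ℝ :=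
  if u ∈ S ∧ #(nbr G u ∩ S) = i then 1 else 0

theorem hitInd_nonneg (G : SimpleGraph V) (i : ℕ) (u : V) (S : Finset V) :
    0 ≤ hitInd G i u S := by
  unfold hitInd; split_ifs <;> norm_num

theorem hitInd_le_one (G : SimpleGraph V) (i : ℕ) (u : V) (S : Finset V) :
    hitInd G i u S ≤ 1 := by
  unfold hitInd; split_ifs <;> norm_num

theorem hitInd_dependsOnInter (G : SimpleGraph V) (i : ℕ) (u : V) :
    DependsOnInter (hitInd G i u) (insert u (nbr G u)) := by
  intro S T h
  have h1 : u ∈ S ↔ u ∈ T := by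
    have := congrArg (u ∈ ·) h
    simpa using this
  have h2 : nbr G u ∩ S = nbr G u ∩ T := by
    ext x
    have := congrArg (x ∈ ·) h
    simp only [mem_inter, mem_insert, eq_iff_iff] at this ⊢
    tauto
  simp [hitInd, h1, h2]

/-- The probability that a vertex of degree `d` is retained and keeps exactly `i` neighbours. -/
noncomputable def hitProb (p : ℝ) (i d : ℕ) : ℝ := p * (d.choose i * p ^ i * (1 - p) ^ (d - i))

theorem hitProb_nonneg {p : ℝ} (hp : 0 ≤ p) (hp' : p ≤ 1) (i d : ℕ) : 0 ≤ hitProb p i d := by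
  have : 0 ≤ 1 - p := by linarith
  unfold hitProb; positivity

theorem bexp_hitInd (p : ℝ) (G : SimpleGraph V) (i : ℕ) (u : V) :
    bexp p Finset.univ (hitInd G i u) = hitProb p i #(nbr G u) := by
  have hu : u ∉ nbr G u := by simp
  rw [(hitInd_dependsOnInter G i u).bexp_eq (Finset.subset_univ _), bexp_insert p hu, hitProb,
    ← bprob_card_eq, bprob, bexp_congr (g := fun _ => 0) fun S hS => ?_, bexp_const, mul_zero,
    zero_add, bexp_congr fun S hS => ?_]
  · simp only [hitInd, mem_insert_self, true_and]
    rw [Finset.inter_insert_of_notMem hu, Finset.inter_eq_right.2 hS]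
    split_ifs <;> rfl
  · have : u ∉ S := fun h => hu (hS h)
    simp [hitInd, this]

theorem sum_adjInd_mul_adjInd (G : SimpleGraph V) (u v : V) :
    ∑ x, adjInd G u x * adjInd G v x = #(nbr G u ∩ nbr G v) := by
  classical
  rw [Finset.cast_card, ← Finset.sum_filter_add_sum_filter_not Finset.univ (· ∈ nbr G u ∩ nbr G v),
    Finset.sum_eq_zero (s := {x | x ∉ nbr G u ∩ nbr G v}), add_zero, Finset.filter_mem_eq_inter,
    Finset.univ_inter]
  · refine Finset.sum_congr rfl fun x hx => ?_
    simp only [mem_inter, mem_nbr] at hx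
    simp [adjInd, hx]
  · intro x hx
    simp only [mem_filter, mem_univ, true_and, mem_inter, mem_nbr, not_and_or] at hx
    rcases hx with hx | hx <;> simp [adjInd, hx]

/-- The closed neighbourhoods meet in nothing (independence), in `{u, v}` (an edge without common
neighbour), in one vertex (a single common neighbour, no edge), or in a configuration with a
triangle on `uv` or two common neighbours. The second and third cases cost `q⁻²`. In the last one
the joint probability is bounded by that of the event for `u`, which suffices because the
configuration is rarer. -/
theorem bexp_hitInd_mul_le {p q : ℝ} (hq : 0 < q) (hqp : q ≤ p) (hqp' : q ≤ 1 - p)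
    (G : SimpleGraph V) (i : ℕ) {u v : V} (huv : u ≠ v) :
    bexp p Finset.univ (fun S => hitInd G i u S * hitInd G i v S) ≤
      hitProb p i #(nbr G u) * hitProb p i #(nbr G v) +
      hitProb p i #(nbr G u) * hitProb p i #(nbr G v) / q ^ 2 *
        (adjInd G u v + ∑ x, adjInd G u x * adjInd G v x) +
      hitProb p i #(nbr G u) * (adjInd G u v * (∑ x, adjInd G u x * adjInd G v x) +
        ∑ x, ∑ y ∈ Finset.univ.erase x,
          adjInd G u x * adjInd G v x * (adjInd G u y * adjInd G v y)) := by
  classical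
  have hp : 0 ≤ p := by linarith
  have hp' : p ≤ 1 := by linarith
  have hq1 : q ≤ 1 := by linarith
  set a := hitProb p i #(nbr G u) with ha
  set b := hitProb p i #(nbr G v) with hb
  have ha0 : 0 ≤ a := hitProb_nonneg hp hp' _ _
  have hb0 : 0 ≤ b := hitProb_nonneg hp hp' _ _
  have hnn : 0 ≤ ∑ x, ∑ y ∈ Finset.univ.erase x,
      adjInd G u x * adjInd G v x * (adjInd G u y * adjInd G v y) :=
    Finset.sum_nonneg fun x _ => Finset.sum_nonneg fun y _ =>
      mul_nonneg (mul_nonneg (adjInd_nonneg ..) (adjInd_nonneg ..))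
        (mul_nonneg (adjInd_nonneg ..) (adjInd_nonneg ..))
  set C := nbr G u ∩ nbr G v with hC
  rw [sum_adjInd_mul_adjInd, ← hC]
  have hcorr := bexp_mul_le hq hqp hqp' (hitInd_nonneg G i u) (hitInd_nonneg G i v)
    (hitInd_dependsOnInter G i u) (hitInd_dependsOnInter G i v)
    (Finset.subset_univ _) (Finset.subset_univ _)
  rw [bexp_hitInd, bexp_hitInd, ← ha, ← hb] at hcorr
  have htriv : bexp p Finset.univ (fun S => hitInd G i u S * hitInd G i v S) ≤ a := by
    rw [ha, ← bexp_hitInd]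
    exact bexp_mono hp hp' fun S _ =>
      mul_le_of_le_one_right (hitInd_nonneg ..) (hitInd_le_one ..)
  set X := bexp p Finset.univ (fun S => hitInd G i u S * hitInd G i v S) with hX
  have hX0 : 0 ≤ X := bexp_nonneg hp hp' fun S _ =>
    mul_nonneg (hitInd_nonneg ..) (hitInd_nonneg ..)
  set W := insert u (nbr G u) ∩ insert v (nbr G v) with hW
  have hcorr2 : #W ≤ 2 → X ≤ a * b / q ^ 2 := by
    intro h
    rw [le_div_iff₀ (by positivity)]
    refine le_trans (mul_le_mul_of_nonneg_left ?_ hX0) hcorr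
    exact pow_le_pow_of_le_one hq.le hq1 h
  have hab : 0 ≤ a * b := mul_nonneg ha0 hb0
  have habq : 0 ≤ a * b / q ^ 2 := by positivity
  by_cases hadj : G.Adj u v
  · have h1 : adjInd G u v = 1 := by simp [adjInd, hadj]
    rw [h1]
    rcases Nat.eq_zero_or_pos #C with h0 | hpos
    · have hWsub : W ⊆ {u, v} := by
        intro x hx
        have : x ∉ C := by rw [Finset.card_eq_zero.1 h0]; simp
        simp only [hW, hC, mem_inter, mem_insert, mem_nbr, mem_singleton] at hx this ⊢
        tauto
      have := hcorr2 ((Finset.card_le_card hWsub).trans Finset.card_le_two)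
      rw [h0]
      push_cast
      nlinarith [mul_nonneg ha0 hnn]
    · have : (1 : ℝ) ≤ #C := by exact_mod_cast hpos
      have h2 : a ≤ a * (1 * (#C : ℝ) + ∑ x, ∑ y ∈ Finset.univ.erase x,
          adjInd G u x * adjInd G v x * (adjInd G u y * adjInd G v y)) :=
        le_mul_of_one_le_right ha0 (by linarith)
      have h3 : 0 ≤ a * b / q ^ 2 * (1 + (#C : ℝ)) := by positivity
      linarith
  · have h1 : adjInd G u v = 0 := by simp [adjInd, hadj]
    have hWC : W = C := by
      ext x
      simp only [hW, hC, mem_inter, mem_insert, mem_nbr]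
      constructor
      · rintro ⟨rfl | h, rfl | h'⟩
        · exact absurd rfl huv
        · exact absurd h'.symm hadj
        · exact absurd h hadj
        · exact ⟨h, h'⟩
      · tauto
    rw [h1]
    rcases Nat.lt_or_ge #C 2 with hlt | hge
    · have h4 : 0 ≤ a * (0 * (#C : ℝ) + ∑ x, ∑ y ∈ Finset.univ.erase x,
          adjInd G u x * adjInd G v x * (adjInd G u y * adjInd G v y)) :=
        mul_nonneg ha0 (by linarith)
      rcases Nat.eq_zero_or_pos #C with h0 | hpos
      · rw [hWC, h0, pow_zero, mul_one] at hcorr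
        have h3 : 0 ≤ a * b / q ^ 2 * (0 + (#C : ℝ)) := by positivity
        linarith
      · have h2 : #C = 1 := by omega
        have := hcorr2 (by rw [hWC]; omega)
        rw [h2] at h4 ⊢
        push_cast at h4 ⊢
        linarith
    · obtain ⟨x, hx, y, hy, hxy⟩ := Finset.one_lt_card.1 hge
      simp only [hC, mem_inter, mem_nbr] at hx hy
      have hone : (1 : ℝ) ≤ ∑ x, ∑ y ∈ Finset.univ.erase x,
          adjInd G u x * adjInd G v x * (adjInd G u y * adjInd G v y) := by
        have hterm : ∀ x y, 0 ≤ adjInd G u x * adjInd G v x * (adjInd G u y * adjInd G v y) :=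
          fun x y => mul_nonneg (mul_nonneg (adjInd_nonneg ..) (adjInd_nonneg ..))
            (mul_nonneg (adjInd_nonneg ..) (adjInd_nonneg ..))
        refine le_trans ?_ (Finset.single_le_sum
          (fun x _ => Finset.sum_nonneg fun y _ => hterm x y) (Finset.mem_univ x))
        refine le_trans ?_ (Finset.single_le_sum (fun y _ => hterm x y)
          (Finset.mem_erase.2 ⟨hxy.symm, Finset.mem_univ y⟩))
        simp [adjInd, hx, hy]
      have h2 : a ≤ a * (0 * (#C : ℝ) + ∑ x, ∑ y ∈ Finset.univ.erase x,
          adjInd G u x * adjInd G v x * (adjInd G u y * adjInd G v y)) :=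
        le_mul_of_one_le_right ha0 (by linarith)
      have h3 : 0 ≤ a * b / q ^ 2 * (0 + (#C : ℝ)) := by positivity
      linarith

/-- The second moment, averaged over the random graph, of the number of vertices in `T` that are
retained and keep exactly `i` neighbours. -/
theorem sum_bexp_hitInd_sub_sq_le {d : V → ℕ} {D : ℕ} (hD : ∀ v, d v ≤ D)
    (hM : 4 * (D * (D + 1)) + 16 ≤ ∑ w, d w) {c : ℝ} {T : Finset V} (hT : ∀ u ∈ T, d u ≤ c)
    {p q : ℝ} (hq : 0 < q) (hqp : q ≤ p) (hqp' : q ≤ 1 - p) (i : ℕ) :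
    ∑ G ∈ degreeFamily d, bexp p Finset.univ (fun S =>
        (∑ u ∈ T, hitInd G i u S - ∑ u ∈ T, hitProb p i (d u)) ^ 2) ≤
      (∑ u ∈ T, hitProb p i (d u) +
        (∑ u ∈ T, hitProb p i (d u)) ^ 2 / q ^ 2 *
          (2 * c ^ 2 / (∑ w, d w : ℕ) + 4 * c ^ 2 * D / (∑ w, d w : ℕ)) +
        (∑ u ∈ T, hitProb p i (d u)) * (#T *
          (8 * c ^ 4 * D / (∑ w, d w : ℕ) ^ 2 + 16 * c ^ 4 * D ^ 2 / (∑ w, d w : ℕ) ^ 2))) *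
        #(degreeFamily d) := by
  have hp : 0 ≤ p := by linarith
  have hp' : p ≤ 1 := by linarith
  set a : V → ℝ := fun u => hitProb p i (d u) with ha
  have ha0 : ∀ u, 0 ≤ a u := fun u => hitProb_nonneg hp hp' _ _
  set m := ∑ u ∈ T, a u with hm
  have hm0 : 0 ≤ m := Finset.sum_nonneg fun u _ => ha0 u
  -- `Y` bounds the covariance of the two hits for fixed `G`; only its average over `G` is small.
  let Y : SimpleGraph V → V → V → ℝ := fun G u v =>
    a u * a v / q ^ 2 * (adjInd G u v + ∑ x, adjInd G u x * adjInd G v x) +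
      a u * (adjInd G u v * (∑ x, adjInd G u x * adjInd G v x) +
        ∑ x, ∑ y ∈ Finset.univ.erase x,
          adjInd G u x * adjInd G v x * (adjInd G u y * adjInd G v y))
  have h1 : ∀ G ∈ degreeFamily d, bexp p Finset.univ (fun S =>
      (∑ u ∈ T, hitInd G i u S - m) ^ 2) ≤ m + ∑ u ∈ T, ∑ v ∈ T.erase u, Y G u v := by
    intro G hG
    rw [mem_degreeFamily] at hG
    have hmean : ∀ u, bexp p Finset.univ (hitInd G i u) = a u := fun u => by
      rw [bexp_hitInd, hG]
    have hpair : ∀ u, ∑ v ∈ T.erase u, bexp p Finset.univ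
        (fun S => hitInd G i u S * hitInd G i v S) ≤
        ∑ v ∈ T.erase u, a u * a v + ∑ v ∈ T.erase u, Y G u v := by
      intro u
      rw [← Finset.sum_add_distrib]
      refine Finset.sum_le_sum fun v hv => ?_
      have := bexp_hitInd_mul_le hq hqp hqp' G i (Finset.ne_of_mem_erase hv).symm
      rw [hG, hG] at this
      simp only [Y, ha]
      linarith
    have hexp : bexp p Finset.univ (fun S => (∑ u ∈ T, hitInd G i u S - m) ^ 2) =
        ∑ u ∈ T, (∑ v ∈ T, bexp p Finset.univ (fun S => hitInd G i u S * hitInd G i v S)) -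
          m ^ 2 := by
      have : (fun S => (∑ u ∈ T, hitInd G i u S - m) ^ 2) = fun S =>
          (∑ u ∈ T, ∑ v ∈ T, hitInd G i u S * hitInd G i v S) +
            ((-(2 * m)) * ∑ u ∈ T, hitInd G i u S + m ^ 2) := by
        funext S
        rw [← Finset.sum_mul_sum]; ring
      rw [this, bexp_add, bexp_add, bexp_const_mul, bexp_const, bexp_sum, bexp_sum]
      simp only [bexp_sum, hmean]
      rw [← hm]; ring
    rw [hexp]
    have hrow : ∀ u ∈ T, ∑ v ∈ T, bexp p Finset.univ
        (fun S => hitInd G i u S * hitInd G i v S) ≤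
        a u + a u * m + ∑ v ∈ T.erase u, Y G u v := by
      intro u hu
      rw [← Finset.add_sum_erase T _ hu]
      have hdiag : bexp p Finset.univ (fun S => hitInd G i u S * hitInd G i u S) ≤ a u := by
        rw [← hmean]
        exact bexp_mono hp hp' fun S _ =>
          mul_le_of_le_one_right (hitInd_nonneg ..) (hitInd_le_one ..)
      have hle : ∑ v ∈ T.erase u, a u * a v ≤ a u * m := by
        rw [hm, Finset.mul_sum]
        exact Finset.sum_le_sum_of_subset_of_nonneg (Finset.erase_subset _ _)
          fun v _ _ => mul_nonneg (ha0 u) (ha0 v)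
      have := hpair u
      linarith
    have := Finset.sum_le_sum hrow
    rw [Finset.sum_add_distrib, Finset.sum_add_distrib, ← Finset.sum_mul, ← hm] at this
    nlinarith
  set F : ℝ := (#(degreeFamily d) : ℝ) with hF
  set e1 : ℝ := 2 * c ^ 2 / (∑ w, d w : ℕ) with he1
  set e2 : ℝ := 4 * c ^ 2 * D / (∑ w, d w : ℕ) with he2
  set e3 : ℝ := 8 * c ^ 4 * D / (∑ w, d w : ℕ) ^ 2 with he3
  set e4 : ℝ := 16 * c ^ 4 * D ^ 2 / (∑ w, d w : ℕ) ^ 2 with he4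
  -- The terms with `e3`, `e4` carry `a u` but not `a v`, so summing over `v` produces the factor
  -- `#T` instead of a second mean.
  have h2 : ∀ u ∈ T, ∀ v ∈ T.erase u, ∑ G ∈ degreeFamily d, Y G u v ≤
      (a u * a v / q ^ 2 * (e1 + e2) + a u * (e3 + e4)) * F := by
    intro u hu v hv
    have hvT := Finset.mem_of_mem_erase hv
    have hne := (Finset.ne_of_mem_erase hv).symm
    have k1 := sum_adjInd_le hD hM (hT u hu) (hT v hvT)
    have k2 := sum_common_le hD hM (hT u hu) (hT v hvT) hne
    have k3 := sum_adj_common_le hD hM (hT u hu) (hT v hvT) hne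
    have k4 := sum_two_common_le hD hM (hT u hu) (hT v hvT) hne
    simp only [Y]
    rw [Finset.sum_add_distrib, ← Finset.mul_sum, ← Finset.mul_sum, Finset.sum_add_distrib,
      Finset.sum_add_distrib, add_mul, mul_assoc, mul_assoc, add_mul, add_mul]
    have hab : 0 ≤ a u * a v / q ^ 2 := div_nonneg (mul_nonneg (ha0 u) (ha0 v)) (by positivity)
    exact add_le_add (mul_le_mul_of_nonneg_left (add_le_add k1 k2) hab)
      (mul_le_mul_of_nonneg_left (add_le_add k3 k4) (ha0 u))
  have hF0 : 0 ≤ F := by positivity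
  have he : 0 ≤ e1 + e2 := by positivity
  have he' : 0 ≤ e3 + e4 := by positivity
  calc _ ≤ ∑ G ∈ degreeFamily d, (m + ∑ u ∈ T, ∑ v ∈ T.erase u, Y G u v) := Finset.sum_le_sum h1
    _ = F * m + ∑ u ∈ T, ∑ v ∈ T.erase u, ∑ G ∈ degreeFamily d, Y G u v := by
      rw [Finset.sum_add_distrib, Finset.sum_const, nsmul_eq_mul, Finset.sum_comm]
      congr 1
      exact Finset.sum_congr rfl fun u _ => Finset.sum_comm
    _ ≤ F * m + ∑ u ∈ T, ∑ v ∈ T, (a u * a v / q ^ 2 * (e1 + e2) + a u * (e3 + e4)) * F := by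
      gcongr with u hu
      refine (Finset.sum_le_sum (h2 u hu)).trans ?_
      refine Finset.sum_le_sum_of_subset_of_nonneg (Finset.erase_subset _ _) fun v _ _ => ?_
      have := ha0 u
      have := ha0 v
      positivity
    _ = _ := by
      have : ∀ u v, (a u * a v / q ^ 2 * (e1 + e2) + a u * (e3 + e4)) * F =
          a u * a v * ((e1 + e2) / q ^ 2 * F) + a u * ((e3 + e4) * F) := by
        intro u v; ring
      simp only [this, Finset.sum_add_distrib, ← Finset.sum_mul, ← Finset.mul_sum,
        Finset.sum_const, nsmul_eq_mul]
      rw [← hm]; ring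

end SecondMoment

/-! ### From measures and multisets to finite sums. -/

section Translation

open Finset

theorem mem_graphsWithDegrees_iff {n : ℕ} {d : Fin n → ℕ} {G : SimpleGraph (Fin n)} :
    G ∈ graphsWithDegrees d ↔ G ∈ degreeFamily d := by
  classical
  rw [mem_degreeFamily]
  refine forall_congr' fun v => ?_
  rw [← SimpleGraph.card_neighborFinset_eq_degree]
  have : nbr G v = G.neighborFinset v := by ext w; simp
  rw [this]

theorem percolationLaw_real_eq {n : ℕ} {d : Fin n → ℕ} (hne : (degreeFamily d).Nonempty)
    (p : unitInterval) (E : Set (SimpleGraph (Fin n) × Set (Fin n))) :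
    (percolationLaw d p).real E =
      (∑ G ∈ degreeFamily d, bprob (p : ℝ) Finset.univ fun S : Finset (Fin n) =>
        (G, (S : Set (Fin n))) ∈ E) /
        #(degreeFamily d) := by
  classical
  have hset : graphsWithDegrees d = (degreeFamily d : Set (SimpleGraph (Fin n))) := by
    ext G; rw [mem_graphsWithDegrees_iff, Finset.mem_coe]
  have hprob : IsProbabilityMeasure (uniformOn (graphsWithDegrees d)) := by
    rw [hset]
    exact isProbabilityMeasure_uniformOn (Finset.finite_toSet _) (by simpa using hne)
  have h1 : ∀ G, (uniformOn (graphsWithDegrees d)).real {G} =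
      if G ∈ degreeFamily d then (#(degreeFamily d) : ℝ)⁻¹ else 0 := by
    intro G
    rw [hset, ← Finset.coe_singleton, measureReal_def, uniformOn_apply_finset]
    split_ifs with h
    · rw [Finset.inter_singleton_of_mem h]
      simp
    · rw [Finset.inter_singleton_of_notMem h]
      simp
  have h2 : ∀ S : Finset (Fin n), (setBernoulli Set.univ p).real {(S : Set (Fin n))} =
      (p : ℝ) ^ #S * (1 - p) ^ #(Finset.univ \ S) := by
    intro S
    rw [setBernoulli_real_singleton p (Set.subset_univ _) Set.finite_univ, Set.ncard_coe_finset,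
      ← Finset.coe_univ, ← Finset.coe_sdiff, Set.ncard_coe_finset]
  have h3 : (percolationLaw d p).real E = ∑ G, ∑ S : Set (Fin n),
      if (G, S) ∈ E then (uniformOn (graphsWithDegrees d)).real {G} *
        (setBernoulli Set.univ p).real {S} else 0 := by
    have hE : E = ((Finset.univ.filter (· ∈ E) : Finset (SimpleGraph (Fin n) × Set (Fin n))) :
        Set (SimpleGraph (Fin n) × Set (Fin n))) := by simp
    conv_lhs => rw [hE]
    unfold percolationLaw
    rw [← sum_measureReal_singleton, Finset.sum_filter, ← Finset.univ_product_univ,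
      Finset.sum_product]
    refine Finset.sum_congr rfl fun G _ => Finset.sum_congr rfl fun S _ => ?_
    rw [← Set.singleton_prod_singleton, measureReal_prod_prod]
  rw [h3, Finset.sum_div, ← Finset.sum_filter_add_sum_filter_not Finset.univ (· ∈ degreeFamily d)]
  rw [Finset.sum_eq_zero (s := {G | G ∉ degreeFamily d}), add_zero, Finset.filter_mem_eq_inter,
    Finset.univ_inter]
  · refine Finset.sum_congr rfl fun G hG => ?_
    rw [h1, if_pos hG, bprob, bexp, Finset.sum_div, Finset.powerset_univ]
    rw [← Equiv.sum_comp (Fintype.finsetEquivSet (α := Fin n))]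
    refine Finset.sum_congr rfl fun S _ => ?_
    rw [Fintype.finsetEquivSet_apply, h2]
    split_ifs
    · rw [mul_one, div_eq_mul_inv, mul_comm]
    · simp
  · intro G hG
    simp only [mem_filter, mem_univ, true_and] at hG
    refine Finset.sum_eq_zero fun S _ => ?_
    rw [h1, if_neg hG]
    simp

theorem inducedDegree_coe {n : ℕ} (G : SimpleGraph (Fin n)) (S : Finset (Fin n))
    (v : (S : Set (Fin n))) : inducedDegree G S v = #(nbr G v ∩ S) := by
  classical
  unfold inducedDegree
  rw [← SimpleGraph.card_neighborFinset_eq_degree,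
    ← Finset.card_map (Function.Embedding.subtype (· ∈ (S : Set (Fin n))))]
  congr 1
  ext w
  simp [and_comm]

theorem count_inducedDegreeSeq_coe {n : ℕ} (G : SimpleGraph (Fin n)) (S : Finset (Fin n)) (i : ℕ) :
    ((inducedDegreeSeq G S).count i : ℝ) = ∑ v, hitInd G i v S := by
  classical
  unfold inducedDegreeSeq hitInd
  rw [Multiset.count_map, ← Finset.filter_val, Finset.card_val, ← Finset.natCast_card_filter,
    ← Finset.card_map (Function.Embedding.subtype (· ∈ (S : Set (Fin n))))]
  congr 2
  ext v
  simp only [Finset.mem_map, mem_filter, mem_univ, true_and, inducedDegree_coe]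
  constructor
  · rintro ⟨w, hw, rfl⟩
    exact ⟨w.2, hw.symm⟩
  · rintro ⟨hv, h⟩
    exact ⟨⟨v, hv⟩, h.symm, rfl⟩

theorem setDegree_coe {n : ℕ} (d : Fin n → ℕ) (S : Finset (Fin n)) :
    setDegree d S = ∑ v ∈ S, d v := by
  classical
  unfold setDegree
  refine Finset.sum_congr ?_ fun _ _ => rfl
  ext; simp

theorem abs_natFloor_add_half_sub_le {x : ℝ} (hx : 0 ≤ x) : |(⌊x + 1 / 2⌋₊ : ℝ) - x| ≤ 1 / 2 := by
  rw [abs_le]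
  have h1 := Nat.floor_le (show 0 ≤ x + 1 / 2 by positivity)
  have h2 := Nat.lt_floor_add_one (x + 1 / 2)
  constructor <;> linarith

/-- The model sequence has, up to rounding, the expected number of entries equal to `i`. -/
theorem abs_modelCount_sub_le {n : ℕ} (d : Fin n → ℕ) (p : unitInterval) (i : ℕ) :
    |((modelCount d p i : ℕ) : ℝ) - ∑ v, hitProb p i (d v)| ≤ 1 := by
  have hp : (0 : ℝ) ≤ p := p.2.1
  have hnn : ∀ k, 0 ≤ (p : ℝ) * ∑ v, (binomial (d v) p).real (Set.Iic k) := fun k =>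
    mul_nonneg hp (Finset.sum_nonneg fun v _ => measureReal_nonneg)
  have hhit : ∀ k, ∑ v, hitProb p k (d v) = p * ∑ v, (binomial (d v) p).real {k} := by
    intro k
    rw [Finset.mul_sum]
    exact Finset.sum_congr rfl fun v _ => by rw [hitProb, binomial_real_singleton]
  cases i with
  | zero =>
    have h0 : (Set.Iic 0 : Set ℕ) = {0} := by ext; simp
    have := abs_natFloor_add_half_sub_le (hnn 0)
    rw [h0, ← hhit] at this
    rw [modelCount, modelCdf, h0, ← hhit]
    linarith
  | succ k =>
    have hsplit : ∀ v, (binomial (d v) p).real (Set.Iic (k + 1)) =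
        (binomial (d v) p).real (Set.Iic k) + (binomial (d v) p).real {k + 1} := by
      intro v
      rw [← measureReal_union (by simp) (by measurability)]
      congr 1
      ext x
      simp only [Set.mem_Iic, Set.mem_union, Set.mem_singleton_iff]
      omega
    -- The count is a difference of two roundings, each with error at most one half.
    have h1 := abs_natFloor_add_half_sub_le (hnn k)
    have h2 := abs_natFloor_add_half_sub_le (hnn (k + 1))
    have h3 : (p : ℝ) * ∑ v, (binomial (d v) p).real (Set.Iic (k + 1)) =
        p * ∑ v, (binomial (d v) p).real (Set.Iic k) + ∑ v, hitProb p (k + 1) (d v) := by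
      rw [hhit, ← mul_add, ← Finset.sum_add_distrib]
      simp only [hsplit]
    rw [modelCount, Nat.cast_sub (modelCdf_mono d p (Nat.le_succ k))]
    have h4 : (modelCdf d p k : ℝ) =
        (⌊(p : ℝ) * ∑ v, (binomial (d v) p).real (Set.Iic k) + 1 / 2⌋₊ : ℝ) := rfl
    have h5 : (modelCdf d p (k + 1) : ℝ) =
        (⌊(p : ℝ) * ∑ v, (binomial (d v) p).real (Set.Iic (k + 1)) + 1 / 2⌋₊ : ℝ) := rfl
    rw [h4, h5]
    rw [abs_le] at h1 h2 ⊢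
    constructor <;> linarith [h1.1, h1.2, h2.1, h2.2]

end Translation

/-! ### Explicit estimates for a single degree sequence. -/

section Estimates

open Finset

theorem le_maxDegree {n : ℕ} (d : Fin n → ℕ) (v : Fin n) : d v ≤ maxDegree d :=
  Finset.le_sup (f := d) (Finset.mem_univ v)

/-- The hypotheses on a degree sequence `d` and a retention probability `p` under which the
estimates for a single percolated random graph hold. The parameter `r` stands for
`δ ^ (-1 / 64)`. -/
structure PercolationRegime {n : ℕ} (d : Fin n → ℕ) (p ε r : ℝ) : Prop where
  p_pos : 0 < p
  p_lt_one : p < 1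
  ε_pos : 0 < ε
  p_le : p ≤ 1 - ε
  one_le : ∀ v, 1 ≤ d v
  three_le : 3 ≤ n
  le_r : 18 ≤ r
  one_le_log : 1 ≤ Real.log (totalDegree d)
  even : Even (totalDegree d)
  main : (maxDegree d : ℝ) ^ 2 * (p⁻¹ * Real.log (totalDegree d)) ^ 12 * r ^ 64 ≤
    p * totalDegree d

/-- The cutoff between small and large degrees, in terms of `r = δ ^ (-1 / 64)`. -/
noncomputable def degreeCutoff {n : ℕ} (d : Fin n → ℕ) (p r : ℝ) : ℝ :=
  r ^ 4 * p⁻¹ * Real.log (totalDegree d)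

/-- The large vertex `v` is retained, and its induced degree deviates from its mean. -/
def LargeDeviation {n : ℕ} (d : Fin n → ℕ) (p r : ℝ) (G : SimpleGraph (Fin n)) (v : Fin n)
    (S : Finset (Fin n)) : Prop :=
  v ∈ S ∧ 2 * (r ^ 2)⁻¹ * degreeCutoff d p r < d v ∧
    p * d v * (9 * r⁻¹) < |(#(nbr G v ∩ S) : ℝ) - p * d v|

open Classical in
/-- The vertices of degree at most the cutoff. -/
noncomputable def smallVertices {n : ℕ} (d : Fin n → ℕ) (p r : ℝ) : Finset (Fin n) :=
  {v | (d v : ℝ) ≤ degreeCutoff d p r}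

/-- The expected number of small vertices that are retained and keep exactly `i` neighbours. -/
noncomputable def smallMean {n : ℕ} (d : Fin n → ℕ) (p r : ℝ) (i : ℕ) : ℝ :=
  ∑ v ∈ smallVertices d p r, hitProb p i (d v)

/-- The deviation from `smallMean` that is exceeded with small probability. -/
noncomputable def smallDeviation {n : ℕ} (d : Fin n → ℕ) (p r : ℝ) (i : ℕ) : ℝ :=
  (p * smallMean d p r i / degreeCutoff d p r ^ 3 +
    p * degreeCutoff d p r ^ 6 / √(Real.log (totalDegree d))) / 2

/-- The deviation `t` is large compared with the root of the second moment. -/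
theorem second_moment_le_mul_sq {p ε c D M L m T t : ℝ} (hp : 0 < p) (hp1 : p ≤ 1) (hε : 0 < ε)
    (hD : 1 ≤ D) (hM : 0 < M) (hL : 1 ≤ L) (hLc : L ≤ c * p) (hc0 : 0 < c)
    (hc4 : c ^ 4 * D ^ 2 ≤ M) (hc9 : c ^ 9 * D * L ≤ p ^ 3 * M) (hm : 0 ≤ m) (hT : T ≤ M)
    (htdef : t = (p * m / c ^ 3 + p * c ^ 6 / √L) / 2) :
    m + m ^ 2 / (p * ε) ^ 2 * (2 * c ^ 2 / M + 4 * c ^ 2 * D / M) +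
        m * (T * (8 * c ^ 4 * D / M ^ 2 + 16 * c ^ 4 * D ^ 2 / M ^ 2)) ≤
      (25 + 24 / ε ^ 2) / (p * c * L) * t ^ 2 := by
  have hL0 : 0 < L := by linarith
  have hDD : D ≤ D ^ 2 := by nlinarith
  have hs0 : 0 < √L := Real.sqrt_pos.2 hL0
  have hsL : √L ≤ L := by
    rw [Real.sqrt_le_left hL0.le]; nlinarith
  -- `t` is the mean of two terms. By AM-GM `t²` is at least their product, which controls what is
  -- linear in `m`; the first term alone controls what is quadratic in `m`.
  have ht1 : p ^ 2 * c ^ 3 * m / √L ≤ t ^ 2 := by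
    have hprod : p ^ 2 * c ^ 3 * m / √L = (p * m / c ^ 3) * (p * c ^ 6 / √L) := by field_simp
    rw [hprod, htdef]
    nlinarith [sq_nonneg (p * m / c ^ 3 - p * c ^ 6 / √L)]
  have ht2 : p ^ 2 * m ^ 2 / (4 * c ^ 6) ≤ t ^ 2 := by
    have hsq : p ^ 2 * m ^ 2 / (4 * c ^ 6) = (p * m / c ^ 3 / 2) ^ 2 := by field_simp; norm_num
    rw [hsq, htdef]
    have : 0 ≤ p * c ^ 6 / √L := by positivity
    gcongr
    linarith
  have hmt : m ≤ √L / (p ^ 2 * c ^ 3) * t ^ 2 := by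
    calc m = √L / (p ^ 2 * c ^ 3) * (p ^ 2 * c ^ 3 * m / √L) := by field_simp
      _ ≤ _ := by gcongr
  have hmt2 : m ^ 2 ≤ 4 * c ^ 6 / p ^ 2 * t ^ 2 := by
    calc m ^ 2 = 4 * c ^ 6 / p ^ 2 * (p ^ 2 * m ^ 2 / (4 * c ^ 6)) := by field_simp
      _ ≤ _ := by gcongr
  -- With the leading `m` this gives the 25 of the conclusion. The 24 over `ε²` is 4 from `hmt2`
  -- times 6 from `hE2`.
  have hE1 : T *
      (8 * c ^ 4 * D / M ^ 2 + 16 * c ^ 4 * D ^ 2 / M ^ 2) ≤ 24 := by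
    calc _ ≤ M * (8 * c ^ 4 * D ^ 2 / M ^ 2 + 16 * c ^ 4 * D ^ 2 / M ^ 2) := by gcongr
      _ = 24 * (c ^ 4 * D ^ 2) / M := by field_simp; norm_num
      _ ≤ 24 * M / M := by gcongr
      _ = 24 := by field_simp
  have hE2 : 2 * c ^ 2 / M + 4 * c ^ 2 * D / M ≤ 6 * c ^ 2 * D / M := by
    rw [← add_div]
    gcongr
    nlinarith [mul_le_mul_of_nonneg_left hD (sq_nonneg c)]
  have hA : 25 * (√L / (p ^ 2 * c ^ 3)) ≤ 25 / (p * c * L) := by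
    rw [mul_div_assoc', div_le_div_iff₀ (by positivity) (by positivity)]
    have : √L * (p * c * L) ≤ p ^ 2 * c ^ 3 := by
      calc √L * (p * c * L) ≤ L * (p * c * L) := by gcongr
        _ = p * c * (L * L) := by ring
        _ ≤ p * c * ((c * p) * (c * 1)) := by
          gcongr
          exact hLc.trans (by gcongr)
        _ = _ := by ring
    linarith
  have hB : 4 * c ^ 6 / p ^ 2 / (p * ε) ^ 2 * (6 * c ^ 2 * D / M) ≤
      24 / ε ^ 2 / (p * c * L) := by
    have e1 : 4 * c ^ 6 / p ^ 2 / (p * ε) ^ 2 * (6 * c ^ 2 * D / M) =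
        24 / ε ^ 2 * (c ^ 8 * D / (p ^ 4 * M)) := by field_simp; norm_num
    rw [e1, div_eq_mul_one_div (24 / ε ^ 2)]
    refine mul_le_mul_of_nonneg_left ?_ (by positivity)
    rw [div_le_div_iff₀ (by positivity) (by positivity)]
    calc c ^ 8 * D * (p * c * L) = p * (c ^ 9 * D * L) := by ring
      _ ≤ p * (p ^ 3 * M) := by gcongr
      _ = _ := by ring
  calc _ ≤ m + m ^ 2 / (p * ε) ^ 2 * (6 * c ^ 2 * D / M) + m * 24 := by gcongr
    _ = 25 * m + m ^ 2 * (1 / (p * ε) ^ 2 * (6 * c ^ 2 * D / M)) := by ring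
    _ ≤ 25 * (√L / (p ^ 2 * c ^ 3) * t ^ 2) +
        4 * c ^ 6 / p ^ 2 * t ^ 2 * (1 / (p * ε) ^ 2 * (6 * c ^ 2 * D / M)) := by gcongr
    _ = (25 * (√L / (p ^ 2 * c ^ 3)) +
        4 * c ^ 6 / p ^ 2 / (p * ε) ^ 2 * (6 * c ^ 2 * D / M)) * t ^ 2 := by ring
    _ ≤ (25 / (p * c * L) + 24 / ε ^ 2 / (p * c * L)) * t ^ 2 := by gcongr
    _ = _ := by rw [add_div]

namespace PercolationRegime

variable {n : ℕ} {d : Fin n → ℕ} {p ε r : ℝ} (h : PercolationRegime d p ε r)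

include h

theorem one_le_maxDegree : 1 ≤ maxDegree d :=
  (h.one_le ⟨0, by have := h.three_le; omega⟩).trans (le_maxDegree d _)

theorem n_le_totalDegree : n ≤ totalDegree d := by
  have : ∑ _v : Fin n, 1 ≤ totalDegree d := Finset.sum_le_sum fun v _ => h.one_le v
  simpa using this

theorem totalDegree_pos : (0 : ℝ) < totalDegree d := by
  have := h.n_le_totalDegree
  have := h.three_le
  have : 0 < totalDegree d := by omega
  exact_mod_cast this

theorem main' : (maxDegree d : ℝ) ^ 2 * Real.log (totalDegree d) ^ 12 * r ^ 64 ≤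
    p ^ 13 * totalDegree d := by
  have hp := h.p_pos
  have := mul_le_mul_of_nonneg_right h.main (show 0 ≤ p ^ 12 by positivity)
  calc _ = (maxDegree d : ℝ) ^ 2 * (p⁻¹ * Real.log (totalDegree d)) ^ 12 * r ^ 64 * p ^ 12 := by
        field_simp
    _ ≤ _ := this
    _ = _ := by ring

/-- The maximum degree, `log M` and `r` are at least 1 and `p` is at most 1, so any exponent in
`main'` may be lowered. -/
theorem weaken {a b j k : ℕ} (ha : a ≤ 12) (hb : b ≤ 64) (hj : j ≤ 2) (hk : k ≤ 13) :
    (maxDegree d : ℝ) ^ j * Real.log (totalDegree d) ^ a * r ^ b ≤ p ^ k * totalDegree d := by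
  have hL := h.one_le_log
  have hr : 1 ≤ r := by linarith [h.le_r]
  have hD : (1 : ℝ) ≤ maxDegree d := by exact_mod_cast h.one_le_maxDegree
  have hM := h.totalDegree_pos
  refine le_trans ?_ (h.main'.trans ?_)
  · gcongr
  · exact mul_le_mul_of_nonneg_right (pow_le_pow_of_le_one h.p_pos.le h.p_lt_one.le hk) hM.le

theorem sparse : 4 * (maxDegree d * (maxDegree d + 1)) + 16 ≤ ∑ w, d w := by
  have h1 := h.weaken (a := 0) (b := 64) (j := 2) (k := 0) (by norm_num) (by norm_num)
    (by norm_num) (by norm_num)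
  have hr : (18 : ℝ) ^ 64 ≤ r ^ 64 := by
    have := h.le_r
    gcongr
  have h2 : (24 : ℝ) * (maxDegree d : ℝ) ^ 2 ≤ totalDegree d := by
    have h3 : (maxDegree d : ℝ) ^ 2 * 24 ≤ (maxDegree d : ℝ) ^ 2 * r ^ 64 := by
      gcongr
      exact le_trans (by norm_num) hr
    linarith
  have h3 : 24 * maxDegree d ^ 2 ≤ totalDegree d := by exact_mod_cast h2
  have h4 := h.one_le_maxDegree
  change _ ≤ totalDegree d
  nlinarith

theorem degreeFamily_nonempty : (degreeFamily d).Nonempty := by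
  refine _root_.degreeFamily_nonempty (le_maxDegree d) h.even ?_
  have := h.sparse
  have := Nat.mul_le_mul_right (maxDegree d * (maxDegree d + 1)) (show 3 ≤ 4 by norm_num)
  omega

theorem degreeCutoff_mul : degreeCutoff d p r * p = r ^ 4 * Real.log (totalDegree d) := by
  have := h.p_pos
  unfold degreeCutoff
  field_simp

theorem log_le_cutoff_mul : Real.log (totalDegree d) ≤ degreeCutoff d p r * p := by
  rw [h.degreeCutoff_mul]
  have hr : 1 ≤ r := by linarith [h.le_r]
  exact le_mul_of_one_le_left (by linarith [h.one_le_log]) (one_le_pow₀ hr)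

theorem one_le_cutoff : 1 ≤ degreeCutoff d p r := by
  have h1 := h.log_le_cutoff_mul
  have h2 := h.one_le_log
  have h3 := h.p_lt_one
  have h4 := h.p_pos
  nlinarith

/-- The number of retained vertices is concentrated. -/
theorem bprob_card_le :
    bprob p Finset.univ (fun S : Finset (Fin n) =>
      n * p * (3 * √(Real.log n / (p * n))) < |(#S : ℝ) - n * p|) ≤ 1 / (9 * Real.log n) := by
  have hp := h.p_pos
  have hn : (3 : ℝ) ≤ n := by exact_mod_cast h.three_le
  have hn0 : (0 : ℝ) < n := by linarith
  have hlog : 0 < Real.log n := Real.log_pos (by linarith)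
  have ht : 0 < n * p * (3 * √(Real.log n / (p * n))) := by positivity
  refine (bprob_lt_abs_sub_le hp.le h.p_lt_one.le _ _ _ ht).trans ?_
  have hvar := bexp_sum_sub_sq_le p (Finset.univ : Finset (Fin n)) (fun _ => 1)
  simp only [Finset.sum_const, nsmul_eq_mul, mul_one, one_pow, Finset.card_univ,
    Fintype.card_fin] at hvar
  rw [mul_comm p] at hvar
  -- The squared threshold is `9 n p log n`, the variance at most `n p`.
  rw [mul_pow, mul_pow, mul_pow, Real.sq_sqrt (by positivity), div_le_div_iff₀ (by positivity)
    (by positivity)]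
  calc _ ≤ n * p * (9 * Real.log n) := by gcongr
    _ = _ := by field_simp; norm_num

/-- The total degree of the retained vertices is concentrated. -/
theorem bprob_setDegree_le :
    bprob p Finset.univ (fun S : Finset (Fin n) =>
      p * totalDegree d * (p ^ 2 / (totalDegree d : ℝ) ^ (1 / 4 : ℝ)) <
        |((∑ v ∈ S, d v : ℕ) : ℝ) - p * totalDegree d|) ≤ 1 / Real.log (totalDegree d) := by
  have hp := h.p_pos
  have hM := h.totalDegree_pos
  have hL := h.one_le_log
  set M : ℝ := (totalDegree d : ℝ) with hMdef
  set L := Real.log M with hLdef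
  have hL0 : 0 < L := by linarith
  refine (bprob_lt_abs_sub_le hp.le h.p_lt_one.le _ _ _ (by positivity)).trans ?_
  have hvar := bexp_sum_sub_sq_le p (Finset.univ : Finset (Fin n)) (fun v => (d v : ℝ))
  have hsum : ∑ v, (d v : ℝ) = M := by rw [hMdef, totalDegree, Nat.cast_sum]
  rw [hsum] at hvar
  simp only [Nat.cast_sum]
  have hsq : ∑ v, (d v : ℝ) ^ 2 ≤ maxDegree d * M := sum_sq_le_mul_sum (le_maxDegree d)
  have hq : ((M : ℝ) ^ (1 / 4 : ℝ)) ^ 2 = √M := by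
    rw [Real.sqrt_eq_rpow, ← Real.rpow_natCast, ← Real.rpow_mul hM.le]
    norm_num
  have hs0 : 0 < √M := Real.sqrt_pos.2 hM
  -- the main inequality, after taking a square root
  have key : maxDegree d * L ≤ p ^ 5 * √M := by
    have h1 := h.weaken (a := 2) (b := 0) (j := 2) (k := 10) (by norm_num) (by norm_num)
      (by norm_num) (by norm_num)
    rw [pow_zero, mul_one, ← hMdef, ← hLdef] at h1
    refine le_of_sq_le_sq ?_ (by positivity)
    calc (maxDegree d * L) ^ 2 = (maxDegree d : ℝ) ^ 2 * L ^ 2 := by ring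
      _ ≤ p ^ 10 * M := h1
      _ = (p ^ 5 * √M) ^ 2 := by rw [mul_pow, Real.sq_sqrt hM.le]; ring
  -- The squared threshold is `p⁶ M² / √M`, the variance at most `p Δ M`; `key` bounds their ratio
  -- by `1 / L`.
  rw [mul_pow, div_pow, hq, div_le_div_iff₀ (by positivity) hL0]
  calc _ ≤ p * (maxDegree d * M) * L := by
        gcongr
        exact hvar.trans (by gcongr)
    _ = p * M * (maxDegree d * L) := by ring
    _ ≤ p * M * (p ^ 5 * √M) := by gcongr
    _ = _ := by
      have : (p * M) ^ 2 * ((p ^ 2) ^ 2 / √M) = p * M * p ^ 5 * (M / √M) := by field_simp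
      rw [one_mul, this, Real.div_sqrt]; ring

/-- Chernoff with `τ = 9 / r`: above the degree threshold the powers of `r` cancel, and the exponent
`p d(v) τ² / 4` is at least `(81 / 2) log M`, whereas `2 log M` suffices. Below it the event is
empty. -/
theorem bprob_largeDeviation_le {G : SimpleGraph (Fin n)} (hG : G ∈ degreeFamily d) (v : Fin n) :
    bprob p Finset.univ (LargeDeviation d p r G v) ≤ 2 / (totalDegree d : ℝ) ^ 2 := by
  classical
  have hp := h.p_pos
  have hM := h.totalDegree_pos
  have hL := h.one_le_log
  have hr := h.le_r
  have hdeg := mem_degreeFamily.1 hG v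
  have hr0 : 0 < r := by linarith
  by_cases hv : 2 * (r ^ 2)⁻¹ * degreeCutoff d p r < d v
  · have h1 : bprob p Finset.univ (LargeDeviation d p r G v) ≤
        bprob p Finset.univ (fun S => p * #(nbr G v) * (9 * r⁻¹) <
          |(#(nbr G v ∩ S) : ℝ) - p * #(nbr G v)|) := by
      refine bprob_mono hp.le h.p_lt_one.le fun S hS => ?_
      rw [hdeg]
      exact hS.2.2
    have hdep : DependsOnInter (fun S => if p * #(nbr G v) * (9 * r⁻¹) <
        |(#(nbr G v ∩ S) : ℝ) - p * #(nbr G v)| then (1 : ℝ) else 0) (nbr G v) := by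
      intro S T hST
      dsimp only
      rw [Finset.inter_comm _ S, Finset.inter_comm _ T, hST]
    have h2 : bprob p Finset.univ (fun S => p * #(nbr G v) * (9 * r⁻¹) <
          |(#(nbr G v ∩ S) : ℝ) - p * #(nbr G v)|) =
        bprob p (nbr G v) (fun S => p * #(nbr G v) * (9 * r⁻¹) <
          |(#S : ℝ) - p * #(nbr G v)|) := by
      unfold bprob
      rw [hdep.bexp_eq (Finset.subset_univ _)]
      refine bexp_congr fun S hS => ?_
      rw [Finset.inter_eq_right.2 hS]
    have hτ : 9 * r⁻¹ ≤ 1 := by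
      rw [← div_eq_mul_inv, div_le_one hr0]; linarith
    have h3 := bprob_lt_abs_card_sub_le hp.le h.p_lt_one.le (nbr G v) (τ := 9 * r⁻¹)
      (by positivity) hτ
    rw [h2] at h1
    refine h1.trans (h3.trans ?_)
    rw [div_eq_mul_inv]
    refine mul_le_mul_of_nonneg_left ?_ (by norm_num)
    have h4 : ((totalDegree d : ℝ) ^ 2)⁻¹ = Real.exp (-(2 * Real.log (totalDegree d))) := by
      rw [Real.exp_neg, two_mul, Real.exp_add, Real.exp_log hM, sq]
    rw [h4, Real.exp_le_exp, neg_le_neg_iff, hdeg]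
    have h5 : p * (2 * (r ^ 2)⁻¹ * degreeCutoff d p r) ≤ p * d v := by gcongr
    have h6 : p * (2 * (r ^ 2)⁻¹ * degreeCutoff d p r) * (9 * r⁻¹) ^ 2 / 4 =
        81 / 2 * Real.log (totalDegree d) := by
      calc _ = 81 / 2 * (degreeCutoff d p r * p) * (r ^ 4)⁻¹ := by
            field_simp; ring
        _ = _ := by rw [h.degreeCutoff_mul]; field_simp
    have h7 : p * (2 * (r ^ 2)⁻¹ * degreeCutoff d p r) * (9 * r⁻¹) ^ 2 / 4 ≤
        p * d v * (9 * r⁻¹) ^ 2 / 4 := by gcongr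
    linarith
  · have h1 : bprob p Finset.univ (LargeDeviation d p r G v) ≤
        bprob p (Finset.univ : Finset (Fin n)) fun _ => False :=
      bprob_mono hp.le h.p_lt_one.le fun S hS => hv hS.2.1
    refine h1.trans ?_
    simp only [bprob, if_false, bexp_const]
    positivity

theorem sum_bprob_largeDeviation_le {G : SimpleGraph (Fin n)} (hG : G ∈ degreeFamily d) :
    ∑ v, bprob p Finset.univ (LargeDeviation d p r G v) ≤ 2 / totalDegree d := by
  have hM := h.totalDegree_pos
  have hnM : (n : ℝ) ≤ totalDegree d := by exact_mod_cast h.n_le_totalDegree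
  calc _ ≤ ∑ _v : Fin n, 2 / (totalDegree d : ℝ) ^ 2 :=
        Finset.sum_le_sum fun v _ => h.bprob_largeDeviation_le hG v
    _ = n * (2 / (totalDegree d : ℝ) ^ 2) := by simp
    _ ≤ totalDegree d * (2 / (totalDegree d : ℝ) ^ 2) := by gcongr
    _ = _ := by field_simp

/-- A large vertex keeps more than `i` neighbours, unless it has a large deviation. -/
theorem largeDeviation_of_card_eq {G : SimpleGraph (Fin n)} {S : Finset (Fin n)} {v : Fin n}
    {i : ℕ} (hi : (i : ℝ) ≤ 1 / 3 * p * degreeCutoff d p r) (hv : v ∉ smallVertices d p r)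
    (hvS : v ∈ S) (hc : #(nbr G v ∩ S) = i) : LargeDeviation d p r G v S := by
  have hp := h.p_pos
  have hr := h.le_r
  have hc1 := h.one_le_cutoff
  have hr0 : 0 < r := by linarith
  have hv' : degreeCutoff d p r < d v := by simpa [smallVertices] using hv
  refine ⟨hvS, ?_, ?_⟩
  · refine lt_of_le_of_lt ?_ hv'
    have : 2 * (r ^ 2)⁻¹ ≤ 1 := by
      rw [← div_eq_mul_inv, div_le_one (by positivity)]; nlinarith
    exact mul_le_of_le_one_left (by linarith) this
  · rw [hc, lt_abs]
    right
    -- Here `i` lies below one third of the mean `p d(v)`, so any relative deviation up to one half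
    -- is exceeded; this is the origin of the constant 18 in `le_r`.
    have h1 : 9 * r⁻¹ ≤ 1 / 2 := by
      rw [← div_eq_mul_inv, div_le_iff₀ hr0]; linarith
    have h2 : 0 < p * d v := mul_pos hp (by linarith)
    have h3 : p * degreeCutoff d p r < p * d v := by gcongr
    nlinarith

theorem sum_hitProb_sub_smallMean_le {i : ℕ} (hi : (i : ℝ) ≤ 1 / 3 * p * degreeCutoff d p r) :
    smallMean d p r i ≤ ∑ v, hitProb p i (d v) ∧
      ∑ v, hitProb p i (d v) ≤ smallMean d p r i + 1 := by
  classical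
  -- The sum depends on `d` alone, so any one graph serves to read `hitProb` as the probability of
  -- an event, which for a large vertex is contained in `LargeDeviation`.
  obtain ⟨G, hG⟩ := h.degreeFamily_nonempty
  have hp := h.p_pos
  have hM := h.totalDegree_pos
  have h0 : ∀ v, 0 ≤ hitProb p i (d v) := fun v => hitProb_nonneg hp.le h.p_lt_one.le _ _
  refine ⟨Finset.sum_le_univ_sum_of_nonneg h0, ?_⟩
  rw [← Finset.sum_add_sum_compl (smallVertices d p r), smallMean]
  gcongr
  have h1 : ∑ v ∈ (smallVertices d p r)ᶜ, hitProb p i (d v) ≤ 2 / totalDegree d := by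
    refine le_trans ?_ (h.sum_bprob_largeDeviation_le hG)
    refine le_trans (Finset.sum_le_sum fun v hv => ?_) (Finset.sum_le_univ_sum_of_nonneg fun v =>
      bprob_nonneg hp.le h.p_lt_one.le _ _)
    rw [← mem_degreeFamily.1 hG v, ← bexp_hitInd]
    refine bexp_mono hp.le h.p_lt_one.le fun S _ => ?_
    by_cases hS : v ∈ S ∧ #(nbr G v ∩ S) = i
    · have := h.largeDeviation_of_card_eq hi (Finset.mem_compl.1 hv) hS.1 hS.2
      simp [hitInd, hS, this]
    · rw [hitInd, if_neg hS]
      split_ifs <;> norm_num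
  refine h1.trans ?_
  rw [div_le_one hM]
  have := h.n_le_totalDegree
  have := h.three_le
  have : 2 ≤ totalDegree d := by omega
  exact_mod_cast this

theorem smallMean_nonneg (i : ℕ) : 0 ≤ smallMean d p r i :=
  Finset.sum_nonneg fun _ _ => hitProb_nonneg h.p_pos.le h.p_lt_one.le _ _

theorem smallDeviation_pos (i : ℕ) : 0 < smallDeviation d p r i := by
  have := h.smallMean_nonneg i
  have := h.p_pos
  have := h.one_le_cutoff
  have : 0 < degreeCutoff d p r := by linarith
  have : 0 < Real.log (totalDegree d) := by linarith [h.one_le_log]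
  unfold smallDeviation
  positivity

/-- The number of small vertices with exactly `i` retained neighbours is concentrated. -/
theorem sum_bprob_smallDeviation_le (i : ℕ) :
    ∑ G ∈ degreeFamily d, bprob p Finset.univ (fun S => smallDeviation d p r i <
        |∑ v ∈ smallVertices d p r, hitInd G i v S - smallMean d p r i|) ≤
      #(degreeFamily d) * ((25 + 24 / ε ^ 2) /
        (p * degreeCutoff d p r * Real.log (totalDegree d))) := by
  have hp := h.p_pos
  have hε := h.ε_pos
  have hp1 := h.p_lt_one
  have hM := h.totalDegree_pos
  have hr := h.le_r
  have hcp := h.degreeCutoff_mul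
  have hLc := h.log_le_cutoff_mul
  have hc1 := h.one_le_cutoff
  have hL := h.one_le_log
  have ht := h.smallDeviation_pos i
  have hm := h.smallMean_nonneg i
  have hD : (1 : ℝ) ≤ maxDegree d := by exact_mod_cast h.one_le_maxDegree
  -- The choice `q = pε` is a lower bound for both `p` and `1 - p`, since `ε ≤ 1 - p ≤ 1`.
  have hεp : p * ε ≤ 1 - p := by nlinarith [h.p_le]
  have hε1 : p * ε ≤ p := by nlinarith [h.p_le]
  have hpε : 0 < p * ε := mul_pos hp hε
  have hmom := sum_bexp_hitInd_sub_sq_le (le_maxDegree d) h.sparse (c := degreeCutoff d p r)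
    (T := smallVertices d p r) (by simp [smallVertices]) hpε hε1 hεp i
  have hT : (#(smallVertices d p r) : ℝ) ≤ totalDegree d := by
    have h1 : #(smallVertices d p r) ≤ n := by simpa using Finset.card_le_univ (smallVertices d p r)
    exact_mod_cast h1.trans h.n_le_totalDegree
  -- The exponents come from `c p = r⁴ L`: its fourth power for `hc4`, its ninth for `hc9`.
  have hw1 := h.weaken (a := 4) (b := 16) (j := 2) (k := 4) (by norm_num) (by norm_num)
    (by norm_num) (by norm_num)
  have hw2 := h.weaken (a := 10) (b := 36) (j := 1) (k := 12) (by norm_num) (by norm_num)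
    (by norm_num) (by norm_num)
  rw [← smallMean] at hmom
  change _ ≤ (_ + _ * (_ / (totalDegree d : ℝ) + _ / (totalDegree d : ℝ)) +
    _ * (_ * (_ / (totalDegree d : ℝ) ^ 2 + _ / (totalDegree d : ℝ) ^ 2))) * _ at hmom
  have htdef : smallDeviation d p r i = (p * smallMean d p r i / degreeCutoff d p r ^ 3 +
    p * degreeCutoff d p r ^ 6 / √(Real.log (totalDegree d))) / 2 := rfl
  set t := smallDeviation d p r i with ht'
  set m := smallMean d p r i with hm'
  set M : ℝ := (totalDegree d : ℝ) with hM'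
  set L := Real.log M with hL'
  set c := degreeCutoff d p r with hc'
  set D : ℝ := (maxDegree d : ℝ) with hD'
  set F : ℝ := (#(degreeFamily d) : ℝ) with hF'
  have hc0 : 0 < c := by linarith
  have hL0 : 0 < L := by linarith
  have hF0 : 0 ≤ F := by positivity
  have hcheb : ∑ G ∈ degreeFamily d, bprob p Finset.univ (fun S => t <
      |∑ v ∈ smallVertices d p r, hitInd G i v S - m|) ≤
      (∑ G ∈ degreeFamily d, bexp p Finset.univ (fun S =>
        (∑ v ∈ smallVertices d p r, hitInd G i v S - m) ^ 2)) / t ^ 2 := by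
    rw [Finset.sum_div]
    exact Finset.sum_le_sum fun G _ => bprob_lt_abs_sub_le hp.le hp1.le _ _ _ ht
  refine hcheb.trans ?_
  rw [div_le_iff₀ (by positivity)]
  refine hmom.trans ?_
  rw [mul_comm _ F, mul_assoc F]
  refine mul_le_mul_of_nonneg_left ?_ hF0
  have hc4 : c ^ 4 * D ^ 2 ≤ M := by
    have : p ^ 4 * (c ^ 4 * D ^ 2) ≤ p ^ 4 * M := by
      calc _ = D ^ 2 * (c * p) ^ 4 := by ring
        _ = D ^ 2 * L ^ 4 * r ^ 16 := by rw [hcp]; ring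
        _ ≤ _ := hw1
    exact le_of_mul_le_mul_left this (by positivity)
  have hc9 : c ^ 9 * D * L ≤ p ^ 3 * M := by
    have : p ^ 9 * (c ^ 9 * D * L) ≤ p ^ 9 * (p ^ 3 * M) := by
      calc _ = D * L * (c * p) ^ 9 := by ring
        _ = D ^ 1 * L ^ 10 * r ^ 36 := by rw [hcp]; ring
        _ ≤ _ := hw2
        _ = _ := by ring
    exact le_of_mul_le_mul_left this (by positivity)
  exact second_moment_le_mul_sq hp hp1.le hε hD hM hL hLc hc0 hc4 hc9 hm hT htdef

theorem sum_sum_bprob_smallDeviation_le :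
    ∑ i ∈ Finset.range (⌊1 / 3 * p * degreeCutoff d p r⌋₊ + 1), ∑ G ∈ degreeFamily d,
      bprob p Finset.univ (fun S => smallDeviation d p r i <
        |∑ v ∈ smallVertices d p r, hitInd G i v S - smallMean d p r i|) ≤
      #(degreeFamily d) * ((25 + 24 / ε ^ 2) / Real.log (totalDegree d)) := by
  have hp := h.p_pos
  have hε := h.ε_pos
  have hL := h.one_le_log
  have hc := h.one_le_cutoff
  have hcp := h.degreeCutoff_mul
  have hr := h.le_r
  have hpc : 3 ≤ p * degreeCutoff d p r := by
    rw [mul_comm, hcp]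
    have : (18 : ℝ) ^ 4 ≤ r ^ 4 := by gcongr
    nlinarith
  refine (Finset.sum_le_sum fun i _ => h.sum_bprob_smallDeviation_le i).trans ?_
  rw [Finset.sum_const, Finset.card_range, nsmul_eq_mul]
  -- The number of values `i` cancels the factor `p c` in the denominator of the bound for each `i`.
  have hcount : ((⌊1 / 3 * p * degreeCutoff d p r⌋₊ + 1 : ℕ) : ℝ) ≤ p * degreeCutoff d p r := by
    have := Nat.floor_le (show 0 ≤ 1 / 3 * p * degreeCutoff d p r by positivity)
    push_cast
    linarith
  have hL0 : 0 < Real.log (totalDegree d) := by linarith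
  calc _ ≤ p * degreeCutoff d p r * (#(degreeFamily d) * ((25 + 24 / ε ^ 2) /
        (p * degreeCutoff d p r * Real.log (totalDegree d)))) := by gcongr
    _ = _ := by
      have : 0 < degreeCutoff d p r := by linarith
      field_simp

/-- Outside the exceptional events, the numbers of entries of `d_S` and `d_A` are close. -/
theorem abs_sum_hitInd_sub_le {G : SimpleGraph (Fin n)} {S : Finset (Fin n)} {i : ℕ} {N : ℝ}
    (hN0 : 0 ≤ N) (hN : |N - ∑ v, hitProb p i (d v)| ≤ 1)
    (hi : (i : ℝ) ≤ 1 / 3 * p * degreeCutoff d p r)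
    (hlarge : ∀ v, ¬ LargeDeviation d p r G v S)
    (hsmall : |∑ v ∈ smallVertices d p r, hitInd G i v S - smallMean d p r i| ≤
      smallDeviation d p r i) :
    |∑ v, hitInd G i v S - N| ≤ p * N / degreeCutoff d p r ^ 3 +
      p * degreeCutoff d p r ^ 6 / √(Real.log (totalDegree d)) := by
  classical
  have hp := h.p_pos
  have hp1 := h.p_lt_one
  have hL := h.one_le_log
  have hc1 := h.one_le_cutoff
  have hLc := h.log_le_cutoff_mul
  have hcp := h.degreeCutoff_mul
  have hr := h.le_r
  obtain ⟨hm1, hm2⟩ := h.sum_hitProb_sub_smallMean_le hi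
  have hsum : ∑ v, hitInd G i v S = ∑ v ∈ smallVertices d p r, hitInd G i v S := by
    symm
    refine Finset.sum_subset (Finset.subset_univ _) fun v _ hv => ?_
    rw [hitInd, if_neg]
    exact fun hS => hlarge v (h.largeDeviation_of_card_eq hi hv hS.1 hS.2)
  rw [hsum]
  unfold smallDeviation at hsmall
  set m := smallMean d p r i
  set L := Real.log (totalDegree d)
  set c := degreeCutoff d p r
  have hc0 : 0 < c := by linarith
  have hL0 : 0 < L := by linarith
  have hs0 : 0 < √L := Real.sqrt_pos.2 hL0
  have hsL : √L ≤ L := by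
    rw [Real.sqrt_le_left hL0.le]; nlinarith
  have hc3 : 1 ≤ c ^ 3 := one_le_pow₀ hc1
  have hpc3 : p / c ^ 3 ≤ 1 := by
    rw [div_le_one (by positivity)]; linarith
  have hmN : p * m / c ^ 3 ≤ p * N / c ^ 3 + 1 := by
    have : p * m / c ^ 3 ≤ p * (N + 1) / c ^ 3 := by
      gcongr
      linarith [(abs_le.1 hN).1]
    rw [mul_add, add_div, mul_one] at this
    linarith
  have hN1 : 0 ≤ p * N / c ^ 3 := by positivity
  -- `smallDeviation` is half of the target. The other half must absorb 1 for rounding, 1 for large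
  -- vertices, and 1/2 for replacing `m` by `N`, that is 5/2.
  have hbig : 5 ≤ p * c ^ 6 / √L := by
    rw [le_div_iff₀ hs0]
    have h18 : (5 : ℝ) ≤ r ^ 4 := by
      have : (18 : ℝ) ^ 4 ≤ r ^ 4 := by gcongr
      linarith
    calc 5 * √L ≤ r ^ 4 * L := by gcongr
      _ = c * p := hcp.symm
      _ ≤ c * p * c ^ 5 := le_mul_of_one_le_right (by positivity) (one_le_pow₀ hc1)
      _ = _ := by ring
  have h1 : |∑ v ∈ smallVertices d p r, hitInd G i v S - N| ≤
      (p * m / c ^ 3 + p * c ^ 6 / √L) / 2 + 2 := by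
    have h2 := abs_le.1 hN
    have h3 := abs_le.1 hsmall
    rw [abs_le]
    constructor <;> linarith [h2.1, h2.2, h3.1, h3.2]
  linarith

end PercolationRegime

end Estimates

/-! ### Union bound over the exceptional events. -/

section Conclusion

open Finset

theorem percolationLaw_real_le_one {n : ℕ} {d : Fin n → ℕ} (hne : (degreeFamily d).Nonempty)
    (p : unitInterval) (E : Set (SimpleGraph (Fin n) × Set (Fin n))) :
    (percolationLaw d p).real E ≤ 1 := by
  have hF : (0 : ℝ) < #(degreeFamily d) := by exact_mod_cast hne.card_pos
  rw [percolationLaw_real_eq hne, div_le_one hF, Finset.cast_card]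
  refine Finset.sum_le_sum fun G _ => ?_
  rw [bprob_compl]
  linarith [bprob_nonneg p.2.1 p.2.2 Finset.univ
    fun S : Finset (Fin n) => ¬ (G, (S : Set (Fin n))) ∈ E]

/-- The estimates hold for a single percolated random graph, with an explicit error
probability. -/
theorem PercolationRegime.one_sub_le_percolationLaw_real {n : ℕ} {d : Fin n → ℕ}
    {p : unitInterval} {ε r : ℝ} (h : PercolationRegime d p ε r) :
    1 - (1 / (9 * Real.log n) + (28 + 24 / ε ^ 2) / Real.log (totalDegree d)) ≤
      (percolationLaw d p).real
        {GS : SimpleGraph (Fin n) × Set (Fin n) |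
          |(GS.2.ncard : ℝ) - n * p| ≤ n * p * (3 * √(Real.log n / (p * n))) ∧
          |(setDegree d GS.2 : ℝ) - p * totalDegree d| ≤
            p * totalDegree d * ((p : ℝ) ^ 2 / (totalDegree d : ℝ) ^ (1 / 4 : ℝ)) ∧
          (∀ v : GS.2, 2 * (r ^ 2)⁻¹ * degreeCutoff d p r < d v →
            |(inducedDegree GS.1 GS.2 v : ℝ) - p * d v| ≤ p * d v * (9 * r⁻¹)) ∧
          (∀ i : ℕ, (i : ℝ) ≤ 1 / 3 * p * degreeCutoff d p r →
            |((inducedDegreeSeq GS.1 GS.2).count i : ℝ) - (modelSeq d p).count i| ≤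
              p * (modelSeq d p).count i / degreeCutoff d p r ^ 3 +
                p * degreeCutoff d p r ^ 6 / √(Real.log (totalDegree d : ℝ)))} := by
  classical
  have hp : (0 : ℝ) ≤ p := p.2.1
  have hp' : (p : ℝ) ≤ 1 := p.2.2
  have hne := h.degreeFamily_nonempty
  have hF : (0 : ℝ) < #(degreeFamily d) := by exact_mod_cast hne.card_pos
  have hM := h.totalDegree_pos
  have hL := h.one_le_log
  rw [percolationLaw_real_eq hne, le_div_iff₀ hF]
  set E := {GS : SimpleGraph (Fin n) × Set (Fin n) | _} with hE
  let A : Finset (Fin n) → Prop := fun S =>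
    (n : ℝ) * p * (3 * √(Real.log n / (p * n))) < |(#S : ℝ) - n * p|
  let B : Finset (Fin n) → Prop := fun S =>
    (p : ℝ) * totalDegree d * ((p : ℝ) ^ 2 / (totalDegree d : ℝ) ^ (1 / 4 : ℝ)) <
      |((∑ v ∈ S, d v : ℕ) : ℝ) - p * totalDegree d|
  let I := Finset.range (⌊1 / 3 * p * degreeCutoff d p r⌋₊ + 1)
  let Q : SimpleGraph (Fin n) → ℕ → Finset (Fin n) → Prop := fun G i S =>
    smallDeviation d p r i <
      |∑ v ∈ smallVertices d p r, hitInd G i v S - smallMean d p r i|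
  have hgood : ∀ G S, ¬ A S → ¬ B S → (∀ v, ¬ LargeDeviation d p r G v S) →
      (∀ i ∈ I, ¬ Q G i S) → (G, (S : Set (Fin n))) ∈ E := by
    intro G S hA hB hC hQ
    refine ⟨?_, ?_, ?_, ?_⟩
    · dsimp only
      rw [Set.ncard_coe_finset]
      exact not_lt.1 hA
    · dsimp only
      rw [setDegree_coe]
      exact not_lt.1 hB
    · intro v hv
      rw [inducedDegree_coe]
      by_contra hlt
      exact hC v ⟨v.2, hv, not_le.1 hlt⟩
    · intro i hi
      dsimp only
      rw [count_inducedDegreeSeq_coe, count_modelSeq]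
      refine h.abs_sum_hitInd_sub_le (Nat.cast_nonneg _) (abs_modelCount_sub_le d p i) hi hC ?_
      refine not_lt.1 (hQ i (Finset.mem_range.2 (Nat.lt_succ_of_le (Nat.le_floor hi))))
  -- The failure probabilities for (a), (b), (c) are bounded for each `G`. That for (d) is bounded
  -- only after averaging, so its sum over `I` is kept here.
  have hbad : ∀ G ∈ degreeFamily d,
      1 - (1 / (9 * Real.log n) + 1 / Real.log (totalDegree d) + 2 / totalDegree d) -
        ∑ i ∈ I, bprob p Finset.univ (Q G i) ≤
      bprob (p : ℝ) Finset.univ fun S : Finset (Fin n) => (G, (S : Set (Fin n))) ∈ E := by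
    intro G hG
    rw [bprob_compl]
    have h1 : bprob (p : ℝ) Finset.univ (fun S : Finset (Fin n) => ¬ (G, (S : Set (Fin n))) ∈ E) ≤
        bprob (p : ℝ) Finset.univ (fun S => A S ∨ B S ∨
          (∃ v ∈ Finset.univ, LargeDeviation d p r G v S) ∨ ∃ i ∈ I, Q G i S) := by
      refine bprob_mono hp hp' fun S hS => ?_
      by_contra hcon
      simp only [not_or, not_exists, not_and] at hcon
      exact hS (hgood G S hcon.1 hcon.2.1 (fun v => hcon.2.2.1 v (Finset.mem_univ v)) hcon.2.2.2)
    have h2 := bprob_or_le hp hp' Finset.univ A (fun S => B S ∨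
      (∃ v ∈ Finset.univ, LargeDeviation d p r G v S) ∨ ∃ i ∈ I, Q G i S)
    have h3 := bprob_or_le hp hp' Finset.univ B (fun S =>
      (∃ v ∈ Finset.univ, LargeDeviation d p r G v S) ∨ ∃ i ∈ I, Q G i S)
    have h4 := bprob_or_le hp hp' Finset.univ
      (fun S => ∃ v ∈ Finset.univ, LargeDeviation d p r G v S) (fun S => ∃ i ∈ I, Q G i S)
    have h5 := bprob_exists_le hp hp' Finset.univ Finset.univ (LargeDeviation d p r G)
    have h6 := bprob_exists_le hp hp' Finset.univ I (Q G)
    have hA := h.bprob_card_le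
    have hB := h.bprob_setDegree_le
    have hC := h.sum_bprob_largeDeviation_le hG
    linarith
  have hsum := Finset.sum_le_sum hbad
  have hQ := h.sum_sum_bprob_smallDeviation_le
  rw [Finset.sum_comm] at hQ
  rw [Finset.sum_sub_distrib, Finset.sum_const, nsmul_eq_mul] at hsum
  refine le_trans ?_ hsum
  have h2 : 2 / (totalDegree d : ℝ) ≤ 2 / Real.log (totalDegree d) := by
    have := Real.log_le_self hM.le
    have : 0 < Real.log (totalDegree d) := by linarith
    gcongr
  -- 28 is 1 for the total degree, 2 for large deviations and 25 for small vertices.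
  have h3 : (28 + 24 / ε ^ 2) / Real.log (totalDegree d) = 1 / Real.log (totalDegree d) +
      2 / Real.log (totalDegree d) + (25 + 24 / ε ^ 2) / Real.log (totalDegree d) := by
    rw [← add_div, ← add_div]; ring
  have h4 : (#(degreeFamily d) : ℝ) * (1 - (1 / (9 * Real.log n) +
      (28 + 24 / ε ^ 2) / Real.log (totalDegree d))) ≤
      #(degreeFamily d) * (1 - (1 / (9 * Real.log n) + 1 / Real.log (totalDegree d) +
        2 / totalDegree d) - (25 + 24 / ε ^ 2) / Real.log (totalDegree d)) := by
    refine mul_le_mul_of_nonneg_left ?_ hF.le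
    rw [h3]; linarith
  rw [mul_sub _ _ ((25 + 24 / ε ^ 2) / Real.log (totalDegree d))] at h4
  rw [mul_comm _ (#(degreeFamily d) : ℝ)]
  exact h4.trans (sub_le_sub_left hQ _)

end Conclusion

/-! ### Passage to the limit with `r = δ ^ (-1 / 64)`. -/

theorem theorem2p6
    (n : ℕ → ℕ) (hn : Tendsto n atTop atTop)
    (d : (k : ℕ) → Fin (n k) → ℕ)
    (hd_pos : ∀ k v, 1 ≤ d k v)
    (hd_even : ∀ k, Even (totalDegree (d k)))
    (p : ℕ → unitInterval) (hp_pos : ∀ k, 0 < (p k : ℝ))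
    (ε : ℝ) (hε : 0 < ε) (hp_lt : ∀ k, (p k : ℝ) < 1 - ε)
    (δ : ℕ → ℝ) (hδ : Tendsto δ atTop (𝓝 0))
    (hδ_slow : (fun k => (δ k)⁻¹) =O[atTop]
      fun k => Real.log (Real.log (totalDegree (d k) : ℝ)))
    (hmain : ∀ k, (maxDegree (d k) : ℝ) ^ 2 *
        ((p k : ℝ)⁻¹ * Real.log (totalDegree (d k) : ℝ)) ^ 12 ≤
      δ k * p k * totalDegree (d k)) :
    ∃ η : ℕ → ℝ, Tendsto η atTop (𝓝 0) ∧
      Tendsto (fun k => (percolationLaw (d k) (p k)).real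
        {GS : SimpleGraph (Fin (n k)) × Set (Fin (n k)) |
          -- the number of retained vertices
          |(GS.2.ncard : ℝ) - n k * p k| ≤
            n k * p k * (3 * √(Real.log (n k) / (p k * n k))) ∧
          -- the total degree of the retained vertices
          |(setDegree (d k) GS.2 : ℝ) - p k * totalDegree (d k)| ≤
            p k * totalDegree (d k) *
              ((p k : ℝ) ^ 2 / (totalDegree (d k) : ℝ) ^ (1 / 4 : ℝ)) ∧
          -- the induced degrees of the retained vertices of large degree
          (∀ v : GS.2,
            2 * δ k ^ (1 / 32 : ℝ) * cutoff (δ k) (p k) (totalDegree (d k)) < d k v →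
            |(inducedDegree GS.1 GS.2 v : ℝ) - p k * d k v| ≤
              p k * d k v * (9 * δ k ^ (1 / 64 : ℝ))) ∧
          -- the numbers of entries with a given small value
          (∀ i : ℕ, (i : ℝ) ≤ 1 / 3 * p k * cutoff (δ k) (p k) (totalDegree (d k)) →
            |((inducedDegreeSeq GS.1 GS.2).count i : ℝ) - (modelSeq (d k) (p k)).count i| ≤
              p k * (modelSeq (d k) (p k)).count i /
                  cutoff (δ k) (p k) (totalDegree (d k)) ^ 3 * (1 + η k) +
                p k * cutoff (δ k) (p k) (totalDegree (d k)) ^ 6 /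
                  √(Real.log (totalDegree (d k) : ℝ)))})
        atTop (𝓝 1) := by
  have hn' : Tendsto (fun k => (n k : ℝ)) atTop atTop := tendsto_natCast_atTop_atTop.comp hn
  have hlogn : Tendsto (fun k => Real.log (n k)) atTop atTop := Real.tendsto_log_atTop.comp hn'
  have hnM : ∀ k, n k ≤ totalDegree (d k) := by
    intro k
    have : ∑ _v : Fin (n k), 1 ≤ totalDegree (d k) := Finset.sum_le_sum fun v _ => hd_pos k v
    simpa using this
  have hM : Tendsto (fun k => (totalDegree (d k) : ℝ)) atTop atTop :=
    tendsto_atTop_mono (fun k => by exact_mod_cast hnM k) hn'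
  have hlogM : Tendsto (fun k => Real.log (totalDegree (d k) : ℝ)) atTop atTop :=
    Real.tendsto_log_atTop.comp hM
  have hregime : ∀ᶠ k in atTop, 0 < δ k ∧
      PercolationRegime (d k) (p k) ε (δ k ^ (-(1 / 64) : ℝ)) := by
    filter_upwards [hn.eventually_ge_atTop 3, hlogM.eventually_ge_atTop 1,
      hδ.eventually_le_const (show (0 : ℝ) < (18 ^ 64)⁻¹ by positivity)] with k hk3 hkL hkδ
    have hp := hp_pos k
    have hMpos : (0 : ℝ) < totalDegree (d k) := by
      have : 0 < totalDegree (d k) := by have := hnM k; omega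
      exact_mod_cast this
    have hD : (0 : ℝ) < maxDegree (d k) := by
      have : 0 < maxDegree (d k) := (hd_pos k ⟨0, by omega⟩).trans (le_maxDegree _ _)
      exact_mod_cast this
    have hlhs : 0 < (maxDegree (d k) : ℝ) ^ 2 *
        ((p k : ℝ)⁻¹ * Real.log (totalDegree (d k) : ℝ)) ^ 12 := by
      have : 0 < Real.log (totalDegree (d k) : ℝ) := by linarith
      positivity
    -- Positivity of `δ` is forced by `hmain`, whose left side is positive once `log M` is.
    have hδpos : 0 < δ k := by
      have h1 := hlhs.trans_le (hmain k)
      rw [mul_assoc] at h1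
      exact pos_of_mul_pos_left h1 (by positivity)
    have hpow : (δ k ^ (-(1 / 64) : ℝ)) ^ 64 = (δ k)⁻¹ := by
      rw [← Real.rpow_natCast, ← Real.rpow_mul hδpos.le, ← Real.rpow_neg_one]
      norm_num
    refine ⟨hδpos, hp, by linarith [hp_lt k], hε, (hp_lt k).le, hd_pos k, hk3, ?_, hkL, hd_even k,
      ?_⟩
    · refine le_of_pow_le_pow_left₀ (n := 64) (by norm_num) (by positivity) ?_
      rw [hpow]
      exact (le_inv_comm₀ hδpos (by positivity)).1 hkδ
    · rw [hpow, ← div_eq_mul_inv, div_le_iff₀ hδpos]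
      linarith [hmain k]
  -- The half left over in `smallDeviation` absorbs all errors, so the `o(1)` can be taken to be
  -- zero.
  refine ⟨fun _ => 0, tendsto_const_nhds, ?_⟩
  have herr : Tendsto (fun k => 1 - (1 / (9 * Real.log (n k)) +
      (28 + 24 / ε ^ 2) / Real.log (totalDegree (d k)))) atTop (𝓝 1) := by
    have h1 : Tendsto (fun k => 1 / (9 * Real.log (n k))) atTop (𝓝 0) :=
      tendsto_const_nhds.div_atTop (hlogn.const_mul_atTop (by norm_num))
    have h2 : Tendsto (fun k => (28 + 24 / ε ^ 2) / Real.log (totalDegree (d k))) atTop (𝓝 0) :=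
      tendsto_const_nhds.div_atTop hlogM
    simpa using (tendsto_const_nhds (x := (1 : ℝ))).sub (h1.add h2)
  refine tendsto_of_tendsto_of_tendsto_of_le_of_le' herr tendsto_const_nhds ?_ ?_
  · filter_upwards [hregime] with k hk
    obtain ⟨hδpos, hk⟩ := hk
    refine hk.one_sub_le_percolationLaw_real.trans (le_of_eq ?_)
    have e1 : degreeCutoff (d k) (p k) (δ k ^ (-(1 / 64) : ℝ)) =
        cutoff (δ k) (p k) (totalDegree (d k)) := by
      unfold degreeCutoff cutoff
      rw [← Real.rpow_natCast, ← Real.rpow_mul hδpos.le]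
      norm_num
    have e2 : ((δ k ^ (-(1 / 64) : ℝ)) ^ 2)⁻¹ = δ k ^ (1 / 32 : ℝ) := by
      rw [← Real.rpow_natCast, ← Real.rpow_mul hδpos.le, ← Real.rpow_neg hδpos.le]
      norm_num
    have e3 : (δ k ^ (-(1 / 64) : ℝ))⁻¹ = δ k ^ (1 / 64 : ℝ) := by
      rw [← Real.rpow_neg hδpos.le, neg_neg]
    simp only [e1, e2, e3, add_zero, mul_one]
  · filter_upwards [hregime] with k hk
    exact percolationLaw_real_le_one hk.2.degreeFamily_nonempty _ _
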